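/- **Setting.** Let $[m]$ be a finite vertex set and $V=\mathbb{R}^n$, $n\ge 1$. A *(complete simplicial) multi-fan* is a pair $\Delta=(\omega,\lambda)$, where $\omega=\sum_{|I|=n}w(I)I$ is a real simplicial $(n-1)$-cycle (in the augmented chain complex) of the full simplex on $[m]$, and $\lambda\colon[m]\to V$ is such that $\{\lambda(i)\}_{i\in I}$ is a basis of $V$ whenever $w(I)\ne0$. For $c\in\mathbb{R}^m$ let $V_\Delta(c)$ be the volume of the multi-polytope based on $\Delta$ with supporting hyperplanes $H_i=\{u\in V^*\mid\langle u,\lambda(i)\rangle=c_i\}$, that is, the integral over $V^*$ of its Duistermaat–Heckman function. (The latter is computed with a generic vector $v\in V$: every simplex $I$ with $w(I)\neq 0$ contributes its weight, taken for the orientation in which $\lambda(I)$ is a positive basis, times $\prod_{i\in I}\operatorname{sgn}\alpha_{I,i}$, times the indicator function of the cone $\{u\mid \langle u,\lambda(i)\rangle\le c_i \text{ if }\alpha_{I,i}>0,\ \langle u,\lambda(i)\rangle> c_i\text{ if }\alpha_{I,i}<0,\ i\in I\}$, where $v=\sum_{i\in I}\alpha_{I,i}\lambda(i)$.) The function $V_\Delta$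 is a homogeneous polynomial of degree $n$, the *volume polynomial*. Let $\mathcal{D}=\mathbb{R}[\partial_i\mid i\in[m]]$, $\partial_i=\partial/\partial c_i$, $\deg\partial_i=2$, and let $\mathcal{A}^*(\Delta)=\mathcal{D}/\{D\in\mathcal D\mid DV_\Delta=0\}$ be the *duality algebra* of $\Delta$. A cycle $\omega$ is *rigid* if the dimensions $\dim\mathcal{A}^{2j}(\Delta)$ of all multi-fans $\Delta=(\omega,\lambda)$ do not depend on $\lambda$. For a vertex $k$, the *projected cycle* $\omega_k$ is the $(n-2)$-cycle $\sum_{I\not\ni k,\,|I|=n-1}w(\{k\}\sqcup I)\,I$, where the weights are those of the simplices $\{k\}\sqcup I$ oriented with $k$ first. A multi-fan whose cycle is a suspension with apices $x,y$, i.e. the join of a cycle with $S^0=\{x,y\}$, is called *suspension-shaped*; it is *editable* if $\operatorname{im}(\times\partial_y)=\operatorname{Ker}(\times\partial_x)$ for the multiplication operators on its duality algebra. **Theorem.** Let $\Delta'=(\omega,\lambda')$ and $\Delta''=(\omega,\lambda'')$ be multi-fans in $\mathbb{R}^n$ on the same simplicial cycle $\omega$, and let $k\in[m]$ be a vertex such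 that $\lambda'(i)=\lambda''(i)$ for all $i\ne k$. Replace $k$ by two copies $x,y$, set $M=([m]\setminus\{k\})\sqcup\{x,y\}$, let $\lambda\colon M\to V$ be given by $\lambda(i)=\lambda'(i)=\lambda''(i)$ for $i\neq k$, $\lambda(x)=\lambda'(k)$, $\lambda(y)=\lambda''(k)$, and regard $\Delta'$ and $\Delta''$ as multi-fans on $M$ with characteristic function $\lambda$, the cycle of $\Delta'$ passing through $x$ and that of $\Delta''$ through $y$. Let $T=\Delta''-\Delta'$ be the multi-fan with characteristic function $\lambda$ whose cycle is the difference of these two cycles; it is suspension-shaped with apices $x,y$. If the projected cycle $\omega_k$ is rigid and $T$ is editable, then $$\operatorname{Hilb}(\mathcal{A}^*(\Delta');t)=\operatorname{Hilb}(\mathcal{A}^*(\Delta'');t),$$ that is, $\dim\mathcal{A}^{2j}(\Delta')=\dim\mathcal{A}^{2j}(\Delta'')$ for all $j\ge 0$. -/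

import Mathlib

namespace MFan

/-- A real simplicial `(n-1)`-cycle on the finite vertex set `M`, i.e. an element of
`Z_{n-1}(△_M; ℝ)` (augmented chain complex, so the weights of a `0`-cycle add up to `0`).
`coeff I` is the coefficient of the oriented simplex `[I 0, …, I (n-1)]`; it changes by the sign
of the permutation when the vertices are permuted, and hence vanishes on tuples with a repeated
vertex. -/
structure SimplicialCycle (M : Type*) [Fintype M] (n : ℕ) where
  coeff : (Fin n → M) → ℝ
  alternating : ∀ (σ : Equiv.Perm (Fin n)) (I : Fin n → M),
    coeff (I ∘ σ) = (Equiv.Perm.sign σ : ℤ) * coeff I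
  /-- The boundary vanishes: up to sign, the sum below is its coefficient at the simplex obtained
  from `I` by deleting the vertex in position `a`. -/
  closed : ∀ (I : Fin n → M) (a : Fin n), ∑ i : M, coeff (Function.update I a i) = 0

namespace SimplicialCycle

variable {M N : Type*} [Fintype M] [Fintype N] {n : ℕ}

theorem coeff_eq_zero (ω : SimplicialCycle M n) {I : Fin n → M} {a b : Fin n} (hab : a ≠ b)
    (h : I a = I b) : ω.coeff I = 0 := by
  have h1 := ω.alternating (Equiv.swap a b) I
  have h2 : I ∘ Equiv.swap a b = I := by
    funext c
    simp only [Function.comp_apply, Equiv.swap_apply_def]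
    split_ifs with h3 h4
    · rw [h3, h]
    · rw [h4, h]
    · rfl
  rw [h2, Equiv.Perm.sign_swap hab] at h1
  push_cast at h1
  linarith

theorem sum_eq_zero (ω : SimplicialCycle M n) (a : Fin n) (p : (Fin n → M) → Prop)
    [DecidablePred p] (hp : ∀ J i, p (Function.update J a i) ↔ p J) :
    ∑ J : Fin n → M, (if p J then ω.coeff J else 0) = 0 := by
  rw [← (Equiv.funSplitAt a M).symm.sum_comp, Fintype.sum_prod_type_right]
  refine Finset.sum_eq_zero fun r _ => ?_
  rcases isEmpty_or_nonempty M with hM | ⟨⟨i₀⟩⟩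
  · simp
  have key : ∀ i, (Equiv.funSplitAt a M).symm (i, r)
      = Function.update ((Equiv.funSplitAt a M).symm (i₀, r)) a i := by
    intro i
    funext b
    by_cases hb : b = a
    · subst hb; simp
    · simp [hb]
  set J₀ := (Equiv.funSplitAt a M).symm (i₀, r)
  refine (Finset.sum_congr rfl fun i _ => by rw [key i]; simp only [hp]).trans
    (b := ∑ i, if p J₀ then ω.coeff (Function.update J₀ a i) else 0) ?_
  split_ifs
  · exact ω.closed _ _
  · simp

/-- The difference of two simplicial cycles. -/
instance : Sub (SimplicialCycle M n) where
  sub ω η :=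
    { coeff := fun I => ω.coeff I - η.coeff I
      alternating := fun σ I => by rw [ω.alternating, η.alternating]; ring
      closed := fun I a => by rw [Finset.sum_sub_distrib, ω.closed, η.closed, sub_zero] }

/-- The image of a simplicial cycle under a map of vertex sets. -/
def map [DecidableEq N] (f : M → N) (ω : SimplicialCycle M n) : SimplicialCycle N n where
  coeff I := ∑ J : Fin n → M, if f ∘ J = I then ω.coeff J else 0
  alternating σ I := by
    rw [Finset.mul_sum, ← (Equiv.arrowCongr σ.symm (Equiv.refl M)).sum_comp]
    refine Finset.sum_congr rfl fun J _ => ?_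
    have h1 : (Equiv.arrowCongr σ.symm (Equiv.refl M)) J = J ∘ σ := by
      funext b; simp [Equiv.arrowCongr]
    have h2 : f ∘ (J ∘ σ) = I ∘ σ ↔ f ∘ J = I := by
      constructor
      · intro h
        funext b
        simpa using congrFun h (σ.symm b)
      · rintro rfl
        rfl
    rw [h1, ω.alternating]
    simp only [h2, mul_ite, mul_zero]
  closed I a := by
    rw [Finset.sum_comm]
    refine Eq.trans ?_ (ω.sum_eq_zero a (fun J => ∀ b, b ≠ a → f (J b) = I b) ?_)
    · refine Finset.sum_congr rfl fun J _ => ?_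
      have h : ∀ i, f ∘ J = Function.update I a i ↔
          f (J a) = i ∧ ∀ b, b ≠ a → f (J b) = I b := by
        intro i
        constructor
        · intro h
          refine ⟨by simpa using congrFun h a, fun b hb => by simpa [hb] using congrFun h b⟩
        · rintro ⟨h1, h2⟩
          funext b
          by_cases hb : b = a
          · subst hb; simpa using h1
          · simpa [hb] using h2 b hb
      simp_rw [h, ite_and]
      simp
    · intro J i
      refine forall_congr' fun b => imp_congr_right fun hb => ?_
      rw [Function.update_of_ne hb]

/-- The projected cycle `ω_k`, supported on the link of `k`: its coefficient at `J` is the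
coefficient of `ω` at `{k} ⊔ J`. -/
def link (ω : SimplicialCycle M (n + 1)) (k : M) : SimplicialCycle M n where
  coeff J := ω.coeff (Fin.cons k J)
  alternating σ J := by
    have h := ω.alternating (Equiv.Perm.decomposeFin.symm (0, σ)) (Fin.cons k J)
    rw [Equiv.Perm.decomposeFin.symm_sign] at h
    have h2 : (Fin.cons k J : Fin (n + 1) → M) ∘ (Equiv.Perm.decomposeFin.symm (0, σ))
        = Fin.cons k (J ∘ σ) := by
      funext b
      refine Fin.cases ?_ (fun c => ?_) b
      · simp
      · simp
    rw [h2] at h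
    simpa using h
  closed J a := by
    simpa only [Fin.cons_update] using ω.closed (Fin.cons k J) a.succ

/-- `ω` is the suspension `η ∗ S⁰` of a cycle `η` (necessarily `η = ω_x`), with apices `x`, `y`,
where `S⁰ = [x] - [y]`. -/
def IsSuspension (ω : SimplicialCycle M (n + 1)) (x y : M) : Prop :=
  x ≠ y ∧ (∀ J, (ω.link y).coeff J = -(ω.link x).coeff J) ∧
    ∀ I, (∀ a, I a ≠ x ∧ I a ≠ y) → ω.coeff I = 0

end SimplicialCycle

/-- A complete simplicial multi-fan in `V = ℝⁿ` with set of rays indexed by `M`: a simplicial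
`(n-1)`-cycle together with a characteristic function `λ = ray : M → ℝⁿ` which maps the vertices
of every simplex of nonzero weight to a basis (`n` independent vectors). -/
structure MultiFan (M : Type*) [Fintype M] (n : ℕ) where
  cycle : SimplicialCycle M n
  ray : M → Fin n → ℝ
  basis : ∀ I : Fin n → M, cycle.coeff I ≠ 0 → LinearIndependent ℝ (fun a => ray (I a))

/-- The matrix with rows `λ(I 0), …, λ(I (n-1))`. -/
def MultiFan.rayMatrix {M : Type*} [Fintype M] {n : ℕ} (Δ : MultiFan M n) (I : Fin n → M) :
    Matrix (Fin n) (Fin n) ℝ :=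
  Matrix.of fun a => Δ.ray (I a)

section Volume

variable {M : Type*} [Fintype M] {n : ℕ}

/-- The coordinates `α_{I,a}` of `v` in the basis `λ(I 0), …, λ(I (n-1))`. -/
noncomputable def MultiFan.coord (Δ : MultiFan M n) (v : Fin n → ℝ) (I : Fin n → M) :
    Fin n → ℝ :=
  Matrix.vecMul v (Δ.rayMatrix I)⁻¹

/-- `v` is a generic (polarization) vector: all its coordinates in all bases `λ(I)` are nonzero. -/
def MultiFan.IsGeneric (Δ : MultiFan M n) (v : Fin n → ℝ) : Prop :=
  ∀ I, Δ.cycle.coeff I ≠ 0 → ∀ a, Δ.coord v I a ≠ 0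

/-- Signed indicator of the half-line `t ≤ 0` (if `α > 0`), resp. of the flipped half-line
`t > 0` with sign `-1` (otherwise). -/
noncomputable def flip (α t : ℝ) : ℝ :=
  if 0 < α then (if t ≤ 0 then 1 else 0) else (if t ≤ 0 then 0 else -1)

/-- The Duistermaat–Heckman function of the multi-polytope with hyperplanes
`H_i = {u ∈ V* | ⟨u, λ(i)⟩ = c i}`, computed with the polarization vector `v`.
Each simplex `I` of the cycle contributes its weight (taken for the orientation in which `λ(I)` is
a positive basis of `V`) times the signed indicator function of the cone at the vertex `⋂ H_i`
whose edges have been flipped so that `⟨·, v⟩` is bounded above on it.  The sum runs over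
orderings of the simplices, whence the factor `1 / n!`.  For a convex polytope
`{u | ⟨u, λ(i)⟩ ≤ c i}` with its normal fan this is its indicator function. -/
noncomputable def MultiFan.dhFunction (Δ : MultiFan M n) (v : Fin n → ℝ) (c : M → ℝ)
    (u : Fin n → ℝ) : ℝ :=
  (n.factorial : ℝ)⁻¹ * ∑ I : Fin n → M,
    Δ.cycle.coeff I * Real.sign (Δ.rayMatrix I).det *
      ∏ a, flip (Δ.coord v I a) (u ⬝ᵥ Δ.ray (I a) - c (I a))

/-- The volume of the multi-polytope with support parameters `c`, i.e. the integral of its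
Duistermaat–Heckman function over `V* = ℝⁿ`. -/
noncomputable def MultiFan.volume (Δ : MultiFan M n) (v : Fin n → ℝ) (c : M → ℝ) : ℝ :=
  ∫ u : Fin n → ℝ, Δ.dhFunction v c u

/-- `P` is the volume polynomial of `Δ`: its value at every `c` is the volume of the
multi-polytope with support parameters `c`, for every choice of the polarization vector. -/
def MultiFan.IsVolumePolynomial (Δ : MultiFan M n) (P : MvPolynomial M ℝ) : Prop :=
  ∀ v, Δ.IsGeneric v → ∀ c, MvPolynomial.eval c P = Δ.volume v c

open Classical in
/-- The volume polynomial `V_Δ`. -/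
noncomputable def MultiFan.volumePolynomial (Δ : MultiFan M n) : MvPolynomial M ℝ :=
  if h : ∃ P, Δ.IsVolumePolynomial P then h.choose else 0

end Volume

section DualityAlgebra

variable {M : Type*}

theorem pderiv_comm (i j : M) :
    (MvPolynomial.pderiv i : Derivation ℝ (MvPolynomial M ℝ) _).toLinearMap *
        (MvPolynomial.pderiv j : Derivation ℝ (MvPolynomial M ℝ) _).toLinearMap =
      (MvPolynomial.pderiv j : Derivation ℝ (MvPolynomial M ℝ) _).toLinearMap *
        (MvPolynomial.pderiv i : Derivation ℝ (MvPolynomial M ℝ) _).toLinearMap := by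
  classical
  have h : ⁅(MvPolynomial.pderiv i : Derivation ℝ (MvPolynomial M ℝ) _),
      (MvPolynomial.pderiv j : Derivation ℝ (MvPolynomial M ℝ) _)⁆ = 0 := by
    refine MvPolynomial.derivation_ext fun l => ?_
    rw [Derivation.commutator_apply]
    simp [MvPolynomial.pderiv_X, Pi.single_apply, apply_ite]
  refine LinearMap.ext fun P => ?_
  have h2 := congrArg (fun d => d P) h
  simpa [Derivation.commutator_apply, sub_eq_zero] using h2

open scoped IsMulCommutative in
/-- The action of the ring `𝒟 = ℝ[∂_i | i ∈ M]` of differential operators with constant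
coefficients on `ℝ[c_i | i ∈ M]`: the algebra homomorphism that sends the variable `∂_i` to
`∂/∂c_i`. -/
noncomputable def diffOp : MvPolynomial M ℝ →ₐ[ℝ] Module.End ℝ (MvPolynomial M ℝ) :=
  let s : Set (Module.End ℝ (MvPolynomial M ℝ)) :=
    Set.range fun i : M => (MvPolynomial.pderiv i : Derivation ℝ (MvPolynomial M ℝ) _).toLinearMap
  have : IsMulCommutative (Algebra.adjoin ℝ s) := Algebra.isMulCommutative_adjoin ℝ (by
    rintro _ ⟨i, rfl⟩ _ ⟨j, rfl⟩
    exact pderiv_comm i j)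
  (Algebra.adjoin ℝ s).val.comp
    (MvPolynomial.aeval fun i : M => (⟨_, Algebra.subset_adjoin ⟨i, rfl⟩⟩ : Algebra.adjoin ℝ s))

theorem diffOp_X (i : M) (P : MvPolynomial M ℝ) :
    diffOp (MvPolynomial.X i) P = MvPolynomial.pderiv i P := by
  simp [diffOp]

/-- The ideal `Ann P = {D ∈ 𝒟 | D P = 0}`. -/
noncomputable def annihilator (P : MvPolynomial M ℝ) : Ideal (MvPolynomial M ℝ) where
  carrier := {D | diffOp D P = 0}
  zero_mem' := by simp
  add_mem' := by
    intro D E hD hE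
    simp only [Set.mem_ofPred_eq] at hD hE ⊢
    rw [map_add, LinearMap.add_apply, hD, hE, add_zero]
  smul_mem' := by
    intro D E hE
    simp only [Set.mem_ofPred_eq] at hE ⊢
    rw [smul_eq_mul, map_mul, Module.End.mul_apply, hE, map_zero]

variable [Fintype M] {n : ℕ}

/-- The duality algebra `𝒜*(Δ) = 𝒟 / Ann V_Δ` of a multi-fan. -/
abbrev MultiFan.DualityAlgebra (Δ : MultiFan M n) : Type _ :=
  MvPolynomial M ℝ ⧸ annihilator Δ.volumePolynomial

/-- The class of `∂_i` in the duality algebra. -/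
noncomputable def MultiFan.partialClass (Δ : MultiFan M n) (i : M) : Δ.DualityAlgebra :=
  Ideal.Quotient.mk _ (MvPolynomial.X i)

/-- The graded component `𝒜^{2j}(Δ)` (every `∂_i` has degree `2`): the classes of homogeneous
differential operators of order `j`. -/
noncomputable def MultiFan.gradedPiece (Δ : MultiFan M n) (j : ℕ) :
    Submodule ℝ Δ.DualityAlgebra :=
  (MvPolynomial.homogeneousSubmodule M ℝ j).map
    (Ideal.Quotient.mkₐ ℝ (annihilator Δ.volumePolynomial)).toLinearMap

/-- The Hilbert function `j ↦ d_j = dim 𝒜^{2j}(Δ)`, i.e. `Hilb(𝒜*(Δ); t) = ∑ d_j t^{2j}`. -/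
noncomputable def MultiFan.hilbertFunction (Δ : MultiFan M n) (j : ℕ) : ℕ :=
  Module.finrank ℝ (Δ.gradedPiece j)

/-- A simplicial cycle is rigid if the dimensions `dim 𝒜^{2j}(Δ)` of all multi-fans
`Δ = (ω, λ)` on it are independent of `λ`. -/
def SimplicialCycle.Rigid (ω : SimplicialCycle M n) : Prop :=
  ∀ Δ₁ Δ₂ : MultiFan M n, Δ₁.cycle = ω → Δ₂.cycle = ω →
    Δ₁.hilbertFunction = Δ₂.hilbertFunction

/-- A suspension-shaped multi-fan with apices `x`, `y` is editable if
`im (× ∂_y) = ker (× ∂_x)` in its duality algebra. -/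
def MultiFan.Editable (Δ : MultiFan M (n + 1)) (x y : M) : Prop :=
  Δ.cycle.IsSuspension x y ∧
    LinearMap.range (LinearMap.mulLeft ℝ (Δ.partialClass y)) =
      LinearMap.ker (LinearMap.mulLeft ℝ (Δ.partialClass x))

end DualityAlgebra

section Difference

variable {M : Type*} [Fintype M] [DecidableEq M]

/-- The vertex set `([m] ∖ {k}) ⊔ {x, y}` in which `k` has been replaced by two copies. -/
abbrev Doubled (k : M) : Type _ := {i : M // i ≠ k} ⊕ Bool

/-- The first copy of `k`. -/
def apexX (k : M) : Doubled k := Sum.inr false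

/-- The second copy of `k`. -/
def apexY (k : M) : Doubled k := Sum.inr true

/-- The inclusion of the old vertex set that sends `k` to the chosen copy `p`. -/
def inclusion (k : M) (p : Doubled k) (i : M) : Doubled k :=
  if h : i = k then p else Sum.inl ⟨i, h⟩

/-- The characteristic function on the doubled vertex set: `λ'(k)` at `x`, `λ''(k)` at `y`, and
the common value of `λ'` and `λ''` at the other vertices. -/
def doubledRay {n : ℕ} (k : M) (ray' ray'' : M → Fin n → ℝ) : Doubled k → Fin n → ℝ
  | Sum.inl i => ray' i
  | Sum.inr false => ray' k
  | Sum.inr true => ray'' k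

/-- For multi-fans `Δ' = (ω, λ')`, `Δ'' = (ω, λ'')` on the same cycle whose characteristic
functions agree outside `k`, the multi-fan `T = Δ'' - Δ'` on the vertex set
`([m] ∖ {k}) ⊔ {x, y}`, where `Δ'` is placed at the copy `x` of `k` and `Δ''` at the copy `y`. -/
noncomputable def MultiFan.difference {n : ℕ} (k : M) (Δ' Δ'' : MultiFan M n)
    (hray : ∀ i, i ≠ k → Δ'.ray i = Δ''.ray i) : MultiFan (Doubled k) n where
  cycle := Δ''.cycle.map (inclusion k (apexY k)) - Δ'.cycle.map (inclusion k (apexX k))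
  ray := doubledRay k Δ'.ray Δ''.ray
  basis := by
    intro I hI
    have hx : ∀ i, doubledRay k Δ'.ray Δ''.ray (inclusion k (apexX k) i) = Δ'.ray i := by
      intro i
      by_cases h : i = k
      · subst h; simp [inclusion, apexX, doubledRay]
      · simp [inclusion, h, doubledRay]
    have hy : ∀ i, doubledRay k Δ'.ray Δ''.ray (inclusion k (apexY k) i) = Δ''.ray i := by
      intro i
      by_cases h : i = k
      · subst h; simp [inclusion, apexY, doubledRay]
      · simp [inclusion, h, doubledRay, hray i h]
    have hI' : (Δ''.cycle.map (inclusion k (apexY k))).coeff I ≠ 0 ∨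
        (Δ'.cycle.map (inclusion k (apexX k))).coeff I ≠ 0 := by
      by_contra! hcon
      refine hI ?_
      change (Δ''.cycle.map (inclusion k (apexY k))).coeff I -
        (Δ'.cycle.map (inclusion k (apexX k))).coeff I = 0
      rw [hcon.1, hcon.2, sub_zero]
    rcases hI' with h | h
    · obtain ⟨J, -, hJ⟩ := Finset.exists_ne_zero_of_sum_ne_zero h
      obtain ⟨rfl, hJ'⟩ := ite_ne_right_iff.1 hJ
      simpa only [Function.comp_apply, hy] using Δ''.basis J hJ'
    · obtain ⟨J, -, hJ⟩ := Finset.exists_ne_zero_of_sum_ne_zero h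
      obtain ⟨rfl, hJ'⟩ := ite_ne_right_iff.1 hJ
      simpa only [Function.comp_apply, hx] using Δ'.basis J hJ'

/-- The multi-fan `T = Δ'' - Δ'` is always suspension-shaped, with apices `x`, `y`. -/
theorem MultiFan.difference_isSuspension {n : ℕ} (k : M) (Δ' Δ'' : MultiFan M (n + 1))
    (hcycle : Δ'.cycle = Δ''.cycle) (hray : ∀ i, i ≠ k → Δ'.ray i = Δ''.ray i) :
    (MultiFan.difference k Δ' Δ'' hray).cycle.IsSuspension (apexX k) (apexY k) := by
  have hsame : ∀ i, i ≠ k → inclusion k (apexY k) i = inclusion k (apexX k) i := by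
    intro i h
    simp [inclusion, h]
  have hX : ∀ (p : Doubled k) i, inclusion k p i = apexX k → p = apexX k ∧ i = k := by
    intro p i h
    by_cases hi : i = k
    · simpa [inclusion, hi] using h
    · simp [inclusion, hi, apexX] at h
  have hY : ∀ (p : Doubled k) i, inclusion k p i = apexY k → p = apexY k ∧ i = k := by
    intro p i h
    by_cases hi : i = k
    · simpa [inclusion, hi] using h
    · simp [inclusion, hi, apexY] at h
  have hne : apexX k ≠ apexY k := by simp [apexX, apexY]
  have hself : ∀ p : Doubled k, inclusion k p k = p := by
    intro p
    simp [inclusion]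
  refine ⟨hne, fun J => ?_, fun I hI => ?_⟩
  · change (Δ''.cycle.map (inclusion k (apexY k))).coeff (Fin.cons (apexY k) J) -
        (Δ'.cycle.map (inclusion k (apexX k))).coeff (Fin.cons (apexY k) J) =
      -((Δ''.cycle.map (inclusion k (apexY k))).coeff (Fin.cons (apexX k) J) -
        (Δ'.cycle.map (inclusion k (apexX k))).coeff (Fin.cons (apexX k) J))
    have h1 : (Δ'.cycle.map (inclusion k (apexX k))).coeff (Fin.cons (apexY k) J) = 0 := by
      refine Finset.sum_eq_zero fun J' _ => if_neg fun h => hne ?_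
      exact (hY _ (J' 0) (by simpa using congrFun h 0)).1
    have h2 : (Δ''.cycle.map (inclusion k (apexY k))).coeff (Fin.cons (apexX k) J) = 0 := by
      refine Finset.sum_eq_zero fun J' _ => if_neg fun h => hne.symm ?_
      exact (hX _ (J' 0) (by simpa using congrFun h 0)).1
    rw [h1, h2, sub_zero, zero_sub, neg_neg, ← hcycle]
    refine Finset.sum_congr rfl fun J' _ => ?_
    by_cases hJ : Δ'.cycle.coeff J' = 0
    · simp [hJ]
    have hother : J' 0 = k → ∀ b : Fin n, J' b.succ ≠ k := by
      intro h0 b hb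
      exact hJ (Δ'.cycle.coeff_eq_zero (Fin.succ_ne_zero b) (hb.trans h0.symm))
    have hiff : inclusion k (apexY k) ∘ J' = Fin.cons (apexY k) J ↔
        inclusion k (apexX k) ∘ J' = Fin.cons (apexX k) J := by
      constructor
      · intro h
        have h0 : J' 0 = k := (hY _ (J' 0) (by simpa using congrFun h 0)).2
        funext b
        refine Fin.cases ?_ (fun b => ?_) b
        · simp [h0, hself]
        · have := congrFun h b.succ
          simp only [Function.comp_apply, Fin.cons_succ] at this ⊢
          rw [← this, hsame _ (hother h0 b)]
      · intro h
        have h0 : J' 0 = k := (hX _ (J' 0) (by simpa using congrFun h 0)).2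
        funext b
        refine Fin.cases ?_ (fun b => ?_) b
        · simp [h0, hself]
        · have := congrFun h b.succ
          simp only [Function.comp_apply, Fin.cons_succ] at this ⊢
          rw [← this, hsame _ (hother h0 b)]
    simp only [hiff]
  · change (Δ''.cycle.map (inclusion k (apexY k))).coeff I -
        (Δ'.cycle.map (inclusion k (apexX k))).coeff I = 0
    rw [sub_eq_zero, ← hcycle]
    refine Finset.sum_congr rfl fun J _ => ?_
    have hiff : inclusion k (apexY k) ∘ J = I ↔ inclusion k (apexX k) ∘ J = I := by
      constructor
      · rintro rfl
        funext a
        exact (hsame (J a) fun h => (hI a).2 (by simp [h, hself])).symm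
      · rintro rfl
        funext a
        exact hsame (J a) fun h => (hI a).1 (by simp [h, hself])
    simp only [hiff]

end Difference

end MFan

/-! The dimension of `𝒜^{2j}(Δ)` is that of the space of order-`j` derivatives `D V_Δ`, so
everything happens on polynomials. Write `V'`, `V''` for the volume polynomials carried to the
doubled vertex set, so that `∂_x V'' = 0`, `∂_y V' = 0` and `V_T = V'' - V'`.

Comparing ranks reduces to comparing the order-`j` parts of `Ann V'` and `Ann V''`. Both contain the
same subspace, the operators killing `V'` and `V''` together, so only their images under `D ↦ D V_T`
matter. If `D V' = 0`, then `∂_x D V_T = -D ∂_x V' = 0`, and editability makes `D V_T` a derivative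
of `∂_y V_T = ∂_y V''`; conversely `∂_y E` always kills `V'`. Hence the image of `Ann V'` is the
space of order-`(j-1)` derivatives of `∂_y V''`. The mirror statement for `Ann V''` needs `ker ∂_y =
im ∂_x`, which follows from editability by counting dimensions. See
`map_inf_ker_eq_shiftedDerivSpace` and `finrank_derivSpace_eq_of_editable`.

It remains to compare `∂_x V'` with `∂_y V''`. Up to a constant and a linear substitution, `∂_k V_Δ`
is the volume polynomial of a multi-fan on the projected cycle (`exists_projection`), so rigidity of
`ω_k` gives equal dimensions.

The geometric input is Lawrence's formula (`volumePolynomial_eq`). The Duistermaat–Heckman function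
is independent of the polarization, because wall-crossing jumps cancel on a cycle; hence it has
bounded support. Its Laplace transform is an explicit exponential sum over simplices, whose limit at
`0` is a polynomial in `c`. That formula is linear in the cycle and can be differentiated term by
term. -/

namespace MFan

/-! ### Differential operators, linear substitutions and spaces of derivatives -/

section Derivatives

open MvPolynomial

variable {M N : Type*}

theorem diffOp_C (a : ℝ) (P : MvPolynomial M ℝ) : diffOp (C a) P = C a * P := by
  rw [← algebraMap_eq, AlgHom.commutes, Module.algebraMap_end_apply, smul_eq_C_mul, algebraMap_eq]

theorem diffOp_mul (D E P : MvPolynomial M ℝ) : diffOp (D * E) P = diffOp D (diffOp E P) := by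
  rw [map_mul, Module.End.mul_apply]

theorem diffOp_X_mul (i : M) (D P : MvPolynomial M ℝ) :
    diffOp (X i * D) P = pderiv i (diffOp D P) := by
  rw [diffOp_mul, diffOp_X]

theorem diffOp_X_mul' (i : M) (D P : MvPolynomial M ℝ) :
    diffOp (X i * D) P = diffOp D (pderiv i P) := by
  rw [mul_comm, diffOp_mul, diffOp_X]

/-- The linear map `D ↦ D P` for a fixed polynomial `P`. -/
noncomputable def applyOp (P : MvPolynomial M ℝ) :
    MvPolynomial M ℝ →ₗ[ℝ] MvPolynomial M ℝ :=
  (LinearMap.applyₗ P).comp diffOp.toLinearMap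

@[simp] theorem applyOp_apply (P D : MvPolynomial M ℝ) : applyOp P D = diffOp D P := rfl

/-- The space of all derivatives `D P` of `P` with `D` homogeneous of order `j`. -/
noncomputable def derivSpace (P : MvPolynomial M ℝ) (j : ℕ) : Submodule ℝ (MvPolynomial M ℝ) :=
  (homogeneousSubmodule M ℝ j).map (applyOp P)

instance [Finite M] (j : ℕ) : Module.Finite ℝ (homogeneousSubmodule M ℝ j) := by
  have h : homogeneousSubmodule M ℝ j ≤ restrictTotalDegree M ℝ j := fun p hp => by
    rw [mem_restrictTotalDegree]
    exact IsHomogeneous.totalDegree_le hp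
  exact Submodule.finiteDimensional_of_le h

instance [Finite M] (P : MvPolynomial M ℝ) (j : ℕ) : Module.Finite ℝ (derivSpace P j) :=
  inferInstanceAs (Module.Finite ℝ ((homogeneousSubmodule M ℝ j).map (applyOp P)))

/-- Homogeneous operators lower the degree of homogeneous polynomials by their order. -/
theorem isHomogeneous_diffOp {D Q : MvPolynomial M ℝ} {e d : ℕ} (hD : D.IsHomogeneous e)
    (hQ : Q.IsHomogeneous d) :
    (e ≤ d → (diffOp D Q).IsHomogeneous (d - e)) ∧ (d < e → diffOp D Q = 0) := by
  classical
  have key : ∀ (e : ℕ) (s : M →₀ ℕ) (a : ℝ), s.degree = e →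
      (e ≤ d → (diffOp (monomial s a) Q).IsHomogeneous (d - e)) ∧
        (d < e → diffOp (monomial s a) Q = 0) := by
    intro e
    induction e with
    | zero =>
      intro s a hs
      rw [Finsupp.degree_eq_zero_iff] at hs
      subst hs
      refine ⟨fun _ => ?_, fun h => absurd h (Nat.not_lt_zero _)⟩
      change (diffOp (C a) Q).IsHomogeneous _
      rw [diffOp_C]
      simpa using (isHomogeneous_C M a).mul hQ
    | succ e ih =>
      intro s a hs
      have hs0 : s ≠ 0 := by
        rintro rfl
        simp at hs
      obtain ⟨i, hi⟩ := Finsupp.ne_iff.1 hs0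
      have hle : Finsupp.single i 1 ≤ s := by
        rw [Finsupp.single_le_iff]
        exact Nat.one_le_iff_ne_zero.2 hi
      obtain ⟨r, rfl⟩ := exists_add_of_le hle
      have hr : r.degree = e := by
        rw [map_add, Finsupp.degree_single] at hs
        omega
      have hmon : monomial (Finsupp.single i 1 + r) a = X i * monomial r a := by
        rw [X, monomial_mul, one_mul]
      rw [hmon, diffOp_X_mul]
      obtain ⟨h1, h2⟩ := ih r a hr
      refine ⟨fun h => ?_, fun h => ?_⟩
      · have := (h1 (by omega)).pderiv (i := i)
        rwa [Nat.sub_sub] at this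
      · rcases Nat.lt_or_ge d e with h3 | h3
        · rw [h2 h3, map_zero]
        · have h4 := h1 h3
          rw [show d - e = 0 by omega] at h4
          rw [totalDegree_eq_zero_iff_eq_C.1 (Nat.le_zero.1 h4.totalDegree_le), pderiv_C]
  have hsum : diffOp D Q = ∑ s ∈ D.support, diffOp (monomial s (coeff s D)) Q := by
    conv_lhs => rw [D.as_sum]
    rw [map_sum, LinearMap.sum_apply]
  rw [hsum]
  have hdeg : ∀ s ∈ D.support, s.degree = e := fun s hs => by
    have := hD (mem_support_iff.1 hs)
    rw [Finsupp.degree_eq_weight_one]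
    exact this
  exact ⟨fun h => IsHomogeneous.sum _ _ _ fun s hs => (key e s _ (hdeg s hs)).1 h,
    fun h => Finset.sum_eq_zero fun s hs => (key e s _ (hdeg s hs)).2 h⟩

/-- The annihilator of a homogeneous polynomial is a homogeneous ideal. -/
theorem diffOp_homogeneousComponent_eq_zero {G Q : MvPolynomial M ℝ} {d : ℕ}
    (hQ : Q.IsHomogeneous d) (hG : diffOp G Q = 0) (j : ℕ) :
    diffOp (homogeneousComponent j G) Q = 0 := by
  rcases Nat.lt_or_ge d j with hj | hj
  · exact (isHomogeneous_diffOp (homogeneousComponent_isHomogeneous j G) hQ).2 hj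
  -- The order-`i` part of `G` sends `Q` to degree `d - i`, so the degree `d - j` component of `G Q
  -- = 0` isolates the order-`j` part.
  have hsum : (0 : MvPolynomial M ℝ) = ∑ i ∈ Finset.range (G.totalDegree + 1),
      homogeneousComponent (d - j) (diffOp (homogeneousComponent i G) Q) := by
    conv_lhs => rw [← map_zero (homogeneousComponent (d - j)), ← hG,
      ← sum_homogeneousComponent G]
    rw [map_sum, LinearMap.sum_apply, map_sum]
  have hterm : ∀ i, homogeneousComponent (d - j) (diffOp (homogeneousComponent i G) Q) =
      if i = j then diffOp (homogeneousComponent j G) Q else 0 := by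
    intro i
    have h := isHomogeneous_diffOp (homogeneousComponent_isHomogeneous i G) hQ
    rcases Nat.lt_or_ge d i with hi | hi
    · rw [h.2 hi, map_zero, if_neg (by omega)]
    · rw [homogeneousComponent_of_mem (h.1 hi)]
      by_cases hij : i = j
      · subst hij; simp
      · rw [if_neg (by omega), if_neg hij]
  simp only [hterm, Finset.sum_ite_eq', Finset.mem_range] at hsum
  split_ifs at hsum with h
  · exact hsum.symm
  · rw [homogeneousComponent_eq_zero _ _ (by omega)]
    simp

/-- The algebra map `X i ↦ ∑ j, a i j X j`. -/
noncomputable def linSubst [Fintype N] (a : M → N → ℝ) : MvPolynomial M ℝ →ₐ[ℝ] MvPolynomial N ℝ :=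
  aeval fun i => ∑ j, C (a i j) * X j

theorem linSubst_X [Fintype N] (a : M → N → ℝ) (i : M) :
    linSubst a (X i) = ∑ j, C (a i j) * X j := by
  simp [linSubst]

theorem linSubst_C [Fintype N] (a : M → N → ℝ) (r : ℝ) : linSubst a (C r) = C r := by
  rw [← algebraMap_eq, AlgHom.commutes, algebraMap_eq]

theorem isHomogeneous_linSubst [Fintype N] (a : M → N → ℝ) {P : MvPolynomial M ℝ} {d : ℕ}
    (hP : P.IsHomogeneous d) : (linSubst a P).IsHomogeneous d := by
  have := hP.aeval (n := 1) (fun i => ∑ j, C (a i j) * X j : M → MvPolynomial N ℝ)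
    (fun i => IsHomogeneous.sum _ _ _ fun j _ => by
      simpa using (isHomogeneous_C N (a i j)).mul (isHomogeneous_X ℝ j))
  simpa [linSubst] using this

theorem pderiv_linSubst [Fintype M] [Fintype N] (a : M → N → ℝ) (j : N) (P : MvPolynomial M ℝ) :
    pderiv j (linSubst a P) = ∑ i, C (a i j) * linSubst a (pderiv i P) := by
  classical
  induction P using MvPolynomial.induction_on with
  | C r => simp [← algebraMap_eq]
  | add p q hp hq => simp only [map_add, hp, hq, mul_add, Finset.sum_add_distrib]
  | mul_X p l hp =>
    have h1 : pderiv j (linSubst a (X l)) = C (a l j) := by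
      rw [linSubst_X, map_sum]
      simp [pderiv_X, Pi.single_apply]
    rw [map_mul, Derivation.leibniz, hp, h1]
    simp only [Derivation.leibniz, pderiv_X, map_add, smul_eq_mul, map_mul, mul_add,
      Finset.sum_add_distrib, Finset.mul_sum]
    congr 1
    · rw [Finset.sum_eq_single l]
      · simp [mul_comm]
      · intro i _ hi
        simp [hi]
      · simp
    · exact Finset.sum_congr rfl fun i _ => by ring

/-- Chain rule: constant-coefficient operators pull back through a linear substitution by the
transposed matrix. -/
theorem diffOp_linSubst [Fintype M] [Fintype N] (a : M → N → ℝ) (D : MvPolynomial N ℝ)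
    (P : MvPolynomial M ℝ) :
    diffOp D (linSubst a P) = linSubst a (diffOp (linSubst (fun j i => a i j) D) P) := by
  induction D using MvPolynomial.induction_on generalizing P with
  | C r => simp [← algebraMap_eq, Module.algebraMap_end_apply]
  | add p q hp hq => simp only [map_add, LinearMap.add_apply, hp, hq]
  | mul_X p l hp =>
    rw [diffOp_mul, diffOp_X, pderiv_linSubst, map_mul, diffOp_mul, linSubst_X]
    simp only [map_sum, LinearMap.sum_apply, diffOp_mul, diffOp_C, diffOp_X]
    simp only [← smul_eq_C_mul, map_smul, hp]

theorem finrank_derivSpace_linSubst_le [Fintype M] [Fintype N] (a : M → N → ℝ)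
    (P : MvPolynomial M ℝ) (j : ℕ) :
    Module.finrank ℝ (derivSpace (linSubst a P) j) ≤ Module.finrank ℝ (derivSpace P j) := by
  have h : derivSpace (linSubst a P) j ≤ (derivSpace P j).map (linSubst a).toLinearMap := by
    rintro _ ⟨D, hD, rfl⟩
    exact ⟨_, ⟨_, isHomogeneous_linSubst _ hD, rfl⟩, (diffOp_linSubst a D P).symm⟩
  exact (Submodule.finrank_mono h).trans (Submodule.finrank_map_le _ _)

/-- The substitution has to be undone only on `P` itself. This matters for the shear used in the
projection, which sends one variable to `0`. -/
theorem finrank_derivSpace_linSubst [Fintype M] [Fintype N] (a : M → N → ℝ) (b : N → M → ℝ)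
    (P : MvPolynomial M ℝ) (h : linSubst b (linSubst a P) = P) (j : ℕ) :
    Module.finrank ℝ (derivSpace (linSubst a P) j) = Module.finrank ℝ (derivSpace P j) := by
  refine le_antisymm (finrank_derivSpace_linSubst_le a P j) ?_
  conv_lhs => rw [← h]
  exact finrank_derivSpace_linSubst_le b _ j

theorem rename_eq_linSubst [Fintype N] [DecidableEq N] (f : M → N) :
    (rename f : MvPolynomial M ℝ →ₐ[ℝ] MvPolynomial N ℝ) =
      linSubst fun i j => if f i = j then 1 else 0 := by
  refine algHom_ext fun i => ?_
  rw [rename_X, linSubst_X, Finset.sum_eq_single (f i)]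
  · simp
  · intro j _ hj
    simp [hj.symm]
  · simp

theorem finrank_derivSpace_rename [Fintype M] [Fintype N] {f : M → N} (hf : Function.Injective f)
    (P : MvPolynomial M ℝ) (j : ℕ) :
    Module.finrank ℝ (derivSpace (rename f P) j) = Module.finrank ℝ (derivSpace P j) := by
  classical
  rw [rename_eq_linSubst]
  refine finrank_derivSpace_linSubst _ (fun j i => if f i = j then 1 else 0) P ?_ j
  rw [← AlgHom.comp_apply]
  refine (congrArg (fun g : MvPolynomial M ℝ →ₐ[ℝ] MvPolynomial M ℝ => g P)
    (algHom_ext (g := AlgHom.id ℝ _) fun i => ?_)).trans rfl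
  rw [AlgHom.comp_apply, ← rename_eq_linSubst, rename_X, linSubst_X, Finset.sum_eq_single i]
  · simp
  · intro l _ hl
    simp [hf.ne hl]
  · simp

theorem derivSpace_C_mul {r : ℝ} (hr : r ≠ 0) (P : MvPolynomial M ℝ) (j : ℕ) :
    derivSpace (C r * P) j = derivSpace P j := by
  have h : applyOp (C r * P) = r • applyOp P := LinearMap.ext fun D => by
    simp [← smul_eq_C_mul]
  rw [derivSpace, h, Submodule.map_smul _ _ _ hr, derivSpace]

/-- Taking the class of `D` and applying `D` to `V_Δ` have the same kernel, hence the same rank on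
homogeneous operators. -/
theorem MultiFan.hilbertFunction_eq [Fintype M] {n : ℕ} (Δ : MultiFan M n) (j : ℕ) :
    Δ.hilbertFunction j = Module.finrank ℝ (derivSpace Δ.volumePolynomial j) := by
  have key : ∀ (V₁ V₂ : Type _) [AddCommGroup V₁] [AddCommGroup V₂] [Module ℝ V₁] [Module ℝ V₂]
      (S : Submodule ℝ (MvPolynomial M ℝ)) (f : MvPolynomial M ℝ →ₗ[ℝ] V₁)
      (g : MvPolynomial M ℝ →ₗ[ℝ] V₂) (_ : ∀ x, f x = 0 ↔ g x = 0),
      Module.finrank ℝ (S.map f) = Module.finrank ℝ (S.map g) := by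
    intro V₁ V₂ _ _ _ _ S f g h
    rw [← LinearMap.range_domRestrict, ← LinearMap.range_domRestrict]
    have hk : LinearMap.ker (f.domRestrict S) = LinearMap.ker (g.domRestrict S) := by
      ext x
      exact h x
    exact ((f.domRestrict S).quotKerEquivRange.symm.trans
      ((Submodule.quotEquivOfEq _ _ hk).trans (g.domRestrict S).quotKerEquivRange)).finrank_eq
  refine key _ _ _ _ _ fun D => ?_
  change Ideal.Quotient.mk _ D = 0 ↔ _
  rw [Ideal.Quotient.eq_zero_iff_mem]
  rfl

end Derivatives

/-! ### Rank–nullity on a subspace -/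

section RankNullity

variable {E F : Type*} [AddCommGroup E] [Module ℝ E] [AddCommGroup F] [Module ℝ F]

theorem finrank_map_add_finrank_inf_ker (S : Submodule ℝ E) [Module.Finite ℝ S] (f : E →ₗ[ℝ] F) :
    Module.finrank ℝ (S.map f) + Module.finrank ℝ (S ⊓ LinearMap.ker f : Submodule ℝ E) =
      Module.finrank ℝ S := by
  rw [← LinearMap.finrank_range_add_finrank_ker (f.domRestrict S), LinearMap.range_domRestrict]
  congr 1
  have h : (LinearMap.ker (f.domRestrict S)).map S.subtype = S ⊓ LinearMap.ker f := by
    rw [LinearMap.ker_domRestrict, Submodule.map_comap_subtype]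
  rw [← h]
  exact Submodule.finrank_map_subtype_eq _ _

/-- If `ker f = im g` on a finite-dimensional space on which `f g = g f = 0`, then
`ker g = im f`. -/
theorem exists_eq_of_ker_eq_range_symm (W : Submodule ℝ E) [Module.Finite ℝ W] (f g : E →ₗ[ℝ] E)
    (hf : ∀ w ∈ W, f w ∈ W) (hg : ∀ w ∈ W, g w ∈ W) (hfg : ∀ w ∈ W, f (g w) = 0)
    (hgf : ∀ w ∈ W, g (f w) = 0) (h : ∀ w ∈ W, f w = 0 → ∃ z ∈ W, g z = w) :
    ∀ w ∈ W, g w = 0 → ∃ z ∈ W, f z = w := by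
  have hker : W ⊓ LinearMap.ker f = W.map g := by
    apply le_antisymm
    · rintro w ⟨hw, hw'⟩
      exact h w hw hw'
    · rintro _ ⟨z, hz, rfl⟩
      exact ⟨hg z hz, hfg z hz⟩
  have hle : W.map f ≤ W ⊓ LinearMap.ker g := by
    rintro _ ⟨z, hz, rfl⟩
    exact ⟨hf z hz, hgf z hz⟩
  have hfin : Module.Finite ℝ (W ⊓ LinearMap.ker g : Submodule ℝ E) :=
    Submodule.finiteDimensional_of_le (S₂ := W) inf_le_left
  -- Since `ker f = im g` on `W`, rank–nullity for `f` and for `g` gives `rank f = dim W - rank g =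
  -- dim ker g`.
  have heq := Submodule.eq_of_le_of_finrank_eq hle (by
    have h1 := finrank_map_add_finrank_inf_ker W f
    have h2 := finrank_map_add_finrank_inf_ker W g
    rw [hker] at h1
    omega)
  intro w hw hw'
  have : w ∈ W ⊓ LinearMap.ker g := ⟨hw, hw'⟩
  rw [← heq] at this
  exact this

end RankNullity

/-! ### The algebraic comparison of `V'` and `V''` -/

section Edit

open MvPolynomial

variable {N : Type*}

/-- Operators of order greater than `d` kill `T`, leaving finitely many finite-dimensional spaces of
derivatives. -/
theorem finiteDimensional_range_applyOp [Finite N] {T : MvPolynomial N ℝ} {d : ℕ}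
    (hT : T.IsHomogeneous d) : Module.Finite ℝ (LinearMap.range (applyOp T)) := by
  have h : LinearMap.range (applyOp T) ≤ (Finset.range (d + 1)).sup (derivSpace T) := by
    rintro _ ⟨D, rfl⟩
    rw [← sum_homogeneousComponent D, map_sum]
    refine Submodule.sum_mem _ fun i _ => ?_
    have hi := homogeneousComponent_isHomogeneous i D
    rcases Nat.lt_or_ge d i with h | h
    · rw [applyOp_apply, (isHomogeneous_diffOp hi hT).2 h]
      exact Submodule.zero_mem _
    · exact Finset.le_sup (f := derivSpace T) (Finset.mem_range.2 (by omega))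
        ⟨_, homogeneousComponent_mem i D, rfl⟩
  exact Submodule.finiteDimensional_of_le h

/-- The condition `ker ∂_x = im ∂_y` on the derivatives of `T` is symmetric in `x` and `y`. -/
theorem editable_symm [Finite N] {T : MvPolynomial N ℝ} {d : ℕ} {x y : N}
    (hT : T.IsHomogeneous d) (hxy : pderiv x (pderiv y T) = 0)
    (hed : ∀ D, diffOp (X x * D) T = 0 → ∃ E, diffOp D T = diffOp (X y * E) T)
    (D : MvPolynomial N ℝ) (hD : diffOp (X y * D) T = 0) :
    ∃ E, diffOp D T = diffOp (X x * E) T := by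
  have hfin := finiteDimensional_range_applyOp hT
  have hmap : ∀ i : N, ∀ Q ∈ LinearMap.range (applyOp T),
      (pderiv i : Derivation ℝ (MvPolynomial N ℝ) _).toLinearMap Q ∈
        LinearMap.range (applyOp T) := by
    rintro i _ ⟨E, rfl⟩
    exact ⟨X i * E, diffOp_X_mul i E T⟩
  have hzero : ∀ E, diffOp (X x * (X y * E)) T = 0 := fun E => by
    rw [← mul_assoc, mul_comm, diffOp_mul, diffOp_X_mul, diffOp_X, hxy, map_zero]
  obtain ⟨_, ⟨E, rfl⟩, hE⟩ := exists_eq_of_ker_eq_range_symm (LinearMap.range (applyOp T))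
    (pderiv x : Derivation ℝ (MvPolynomial N ℝ) _).toLinearMap
    (pderiv y : Derivation ℝ (MvPolynomial N ℝ) _).toLinearMap (hmap x) (hmap y)
    (by
      rintro _ ⟨E, rfl⟩
      change pderiv x (pderiv y (diffOp E T)) = 0
      rw [← diffOp_X_mul, ← diffOp_X_mul, hzero])
    (by
      rintro _ ⟨E, rfl⟩
      change pderiv y (pderiv x (diffOp E T)) = 0
      rw [← diffOp_X_mul, ← diffOp_X_mul, mul_left_comm, hzero])
    (by
      rintro _ ⟨E, rfl⟩ h
      change pderiv x (diffOp E T) = 0 at h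
      obtain ⟨F, hF⟩ := hed E (by rw [diffOp_X_mul, h])
      exact ⟨_, ⟨F, rfl⟩, by
        change pderiv y (diffOp F T) = diffOp E T
        rw [hF, diffOp_X_mul]⟩)
    (diffOp D T) ⟨D, rfl⟩ (by
      change pderiv y (diffOp D T) = 0
      rw [← diffOp_X_mul, hD])
  exact ⟨E, by rw [diffOp_X_mul]; exact hE.symm⟩

theorem homogeneousComponent_zero_X_mul (i : N) (E : MvPolynomial N ℝ) :
    homogeneousComponent 0 (X i * E) = 0 := by
  rw [homogeneousComponent_zero]
  have h : coeff 0 (X i * E) = 0 := by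
    rw [← constantCoeff_eq, map_mul, constantCoeff_X, zero_mul]
  rw [h, C_0]

theorem homogeneousComponent_succ_X_mul (i : N) (E : MvPolynomial N ℝ) (j : ℕ) :
    homogeneousComponent (j + 1) (X i * E) = X i * homogeneousComponent j E := by
  conv_lhs => rw [← sum_homogeneousComponent E, Finset.mul_sum, map_sum]
  have h : ∀ l, homogeneousComponent (j + 1) (X i * homogeneousComponent l E) =
      if l = j then X i * homogeneousComponent j E else 0 := by
    intro l
    rw [homogeneousComponent_of_mem
      ((isHomogeneous_X ℝ i).mul (homogeneousComponent_isHomogeneous l E))]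
    by_cases hl : l = j
    · subst hl; simp [add_comm]
    · rw [if_neg (by omega), if_neg hl]
  simp only [h, Finset.sum_ite_eq', Finset.mem_range]
  split_ifs with hj
  · rfl
  · rw [homogeneousComponent_eq_zero _ _ (by omega), mul_zero]

/-- The space of derivatives of `∂_y T` of order `j - 1`. -/
noncomputable def shiftedDerivSpace (T : MvPolynomial N ℝ) (y : N) :
    ℕ → Submodule ℝ (MvPolynomial N ℝ)
  | 0 => ⊥
  | j + 1 => derivSpace (pderiv y T) j

/-- If `D V = 0`, then `∂_x D T = ± D ∂_x V = 0`, so editability makes `D T` a derivative of `∂_y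
T`. Conversely `∂_y E` kills `V` because `∂_y V = 0`. The choice of sign lets the lemma serve both
`V'` and, with the apices exchanged, `V''`. -/
theorem map_inf_ker_eq_shiftedDerivSpace {T V : MvPolynomial N ℝ} {d : ℕ} {x y : N}
    (hT : T.IsHomogeneous d) (hx : pderiv x T = -pderiv x V ∨ pderiv x T = pderiv x V)
    (hy : pderiv y V = 0)
    (hed : ∀ D, diffOp (X x * D) T = 0 → ∃ E, diffOp D T = diffOp (X y * E) T) (j : ℕ) :
    (homogeneousSubmodule N ℝ j ⊓ LinearMap.ker (applyOp V)).map (applyOp T) =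
      shiftedDerivSpace T y j := by
  apply le_antisymm
  · rintro _ ⟨D, ⟨hD, hDV⟩, rfl⟩
    have hDV' : diffOp D V = 0 := hDV
    obtain ⟨E, hE⟩ := hed D (by
      have h0 : diffOp D (pderiv x V) = 0 := by
        rw [← diffOp_X_mul', diffOp_X_mul, hDV', map_zero]
      rw [diffOp_X_mul']
      rcases hx with hx | hx <;> rw [hx]
      · rw [map_neg, h0, neg_zero]
      · exact h0)
    have h1 : diffOp (D - X y * E) T = 0 := by
      rw [map_sub, LinearMap.sub_apply, hE, sub_self]
    have h2 := diffOp_homogeneousComponent_eq_zero hT h1 j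
    -- Editability provides an inhomogeneous `E`; its component of order `j - 1` is enough, and for
    -- `j = 0` there is none.
    rw [map_sub, homogeneousComponent_eq_self hD, map_sub, LinearMap.sub_apply, sub_eq_zero] at h2
    rw [applyOp_apply, h2]
    cases j with
    | zero =>
      rw [homogeneousComponent_zero_X_mul, map_zero, LinearMap.zero_apply]
      exact Submodule.zero_mem _
    | succ j =>
      rw [homogeneousComponent_succ_X_mul, diffOp_X_mul']
      exact ⟨_, homogeneousComponent_mem j E, rfl⟩
  · cases j with
    | zero => exact bot_le
    | succ j =>
      rintro _ ⟨E, hE, rfl⟩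
      have h : (X y * E).IsHomogeneous (1 + j) :=
        (isHomogeneous_X ℝ y).mul ((mem_homogeneousSubmodule _ _).1 hE)
      rw [add_comm, ← mem_homogeneousSubmodule] at h
      have h2 : X y * E ∈ LinearMap.ker (applyOp V) := by
        rw [LinearMap.mem_ker, applyOp_apply, diffOp_X_mul', hy, map_zero]
      have h3 : applyOp (pderiv y T) E = applyOp T (X y * E) := by
        rw [applyOp_apply, applyOp_apply, diffOp_X_mul']
      rw [h3]
      exact Submodule.mem_map_of_mem ⟨h, h2⟩

/-- Rank–nullity is applied twice on the operators of order `j`: to `D ↦ D V'`, then to `D ↦ D (V''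
- V')` on its kernel, and likewise for `V''`. The images in the second step agree by `hlink`, the
last kernels by `hinf`. -/
theorem finrank_derivSpace_eq_of_editable [Finite N] {V' V'' : MvPolynomial N ℝ} {d : ℕ} {x y : N}
    (hV' : V'.IsHomogeneous d) (hV'' : V''.IsHomogeneous d)
    (hx : pderiv x V'' = 0) (hy : pderiv y V' = 0)
    (hed : ∀ D, diffOp (X x * D) (V'' - V') = 0 →
      ∃ E, diffOp D (V'' - V') = diffOp (X y * E) (V'' - V'))
    (hlink : ∀ j, Module.finrank ℝ (derivSpace (pderiv x V') j) =
      Module.finrank ℝ (derivSpace (pderiv y V'') j)) (j : ℕ) :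
    Module.finrank ℝ (derivSpace V' j) = Module.finrank ℝ (derivSpace V'' j) := by
  have hT : (V'' - V').IsHomogeneous d := hV''.sub hV'
  have hTx : pderiv x (V'' - V') = -pderiv x V' := by rw [map_sub, hx, zero_sub]
  have hTy : pderiv y (V'' - V') = pderiv y V'' := by rw [map_sub, hy, sub_zero]
  have hcomm : pderiv x (pderiv y V'') = 0 := by
    have := LinearMap.congr_fun (pderiv_comm x y) V''
    exact this.trans (by simp [hx])
  have hed' := editable_symm hT (by rw [hTy, hcomm]) hed
  have h1 := map_inf_ker_eq_shiftedDerivSpace hT (Or.inl hTx) hy hed j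
  have h2 := map_inf_ker_eq_shiftedDerivSpace hT (Or.inr hTy) hx hed' j
  have h3 : Module.finrank ℝ (shiftedDerivSpace (V'' - V') y j) =
      Module.finrank ℝ (shiftedDerivSpace (V'' - V') x j) := by
    cases j with
    | zero => rfl
    | succ j =>
      change Module.finrank ℝ (derivSpace (pderiv y (V'' - V')) j) =
        Module.finrank ℝ (derivSpace (pderiv x (V'' - V')) j)
      rw [hTx, hTy, ← hlink, ← derivSpace_C_mul (show (-1 : ℝ) ≠ 0 by norm_num) (pderiv x V')]
      rw [C_neg, C_1, neg_one_mul]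
  set S := homogeneousSubmodule N ℝ j
  have hinf : S ⊓ LinearMap.ker (applyOp V') ⊓ LinearMap.ker (applyOp (V'' - V')) =
      S ⊓ LinearMap.ker (applyOp V'') ⊓ LinearMap.ker (applyOp (V'' - V')) := by
    ext D
    simp only [Submodule.mem_inf, LinearMap.mem_ker, applyOp_apply, map_sub, sub_eq_zero]
    constructor
    · rintro ⟨⟨h, h'⟩, h''⟩
      exact ⟨⟨h, h''.trans h'⟩, h''⟩
    · rintro ⟨⟨h, h'⟩, h''⟩
      exact ⟨⟨h, h''.symm.trans h'⟩, h''⟩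
  have : ∀ V : MvPolynomial N ℝ, Module.Finite ℝ
      (S ⊓ LinearMap.ker (applyOp V) : Submodule ℝ (MvPolynomial N ℝ)) :=
    fun V => Submodule.finiteDimensional_of_le (S₂ := S) inf_le_left
  have e1 := finrank_map_add_finrank_inf_ker S (applyOp V')
  have e2 := finrank_map_add_finrank_inf_ker S (applyOp V'')
  have e3 := finrank_map_add_finrank_inf_ker (S ⊓ LinearMap.ker (applyOp V')) (applyOp (V'' - V'))
  have e4 := finrank_map_add_finrank_inf_ker (S ⊓ LinearMap.ker (applyOp V'')) (applyOp (V'' - V'))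
  rw [h1, hinf] at e3
  rw [h2] at e4
  change Module.finrank ℝ (S.map (applyOp V')) = Module.finrank ℝ (S.map (applyOp V''))
  omega

end Edit

/-! ### Jumps of products of step functions -/

section StepFunctions

variable {ι : Type*} [DecidableEq ι]

/-- The increment of a product of step functions `g a`, each of which jumps by `σ a` at its own
place `τ a`, is the sum of the jumps of the product. -/
theorem prod_step_sub_prod_step (g : ι → ℝ → ℝ) (τ σ : ι → ℝ)
    (hg : ∀ a p q, p < q → p ≠ τ a → q ≠ τ a →
      g a q - g a p = if p < τ a ∧ τ a < q then σ a else 0)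
    (S : Finset ι) (hτ : ∀ a ∈ S, ∀ b ∈ S, a ≠ b → τ a ≠ τ b) (p q : ℝ) (hpq : p < q)
    (hp : ∀ a ∈ S, p ≠ τ a) (hq : ∀ a ∈ S, q ≠ τ a) :
    ∏ a ∈ S, g a q - ∏ a ∈ S, g a p =
      ∑ a ∈ S, if p < τ a ∧ τ a < q then σ a * ∏ b ∈ S.erase a, g b (τ a) else 0 := by
  induction S using Finset.induction_on generalizing p q with
  | empty => simp
  | insert c S hc ih =>
    have ih' := ih fun a ha b hb => hτ a (Finset.mem_insert_of_mem ha) b (Finset.mem_insert_of_mem hb)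
    have hτc : ∀ a ∈ S, τ a ≠ τ c := fun a ha =>
      hτ a (Finset.mem_insert_of_mem ha) c (Finset.mem_insert_self c S) fun h => hc (h ▸ ha)
    have hpS := fun a ha => hp a (Finset.mem_insert_of_mem ha)
    have hqS := fun a ha => hq a (Finset.mem_insert_of_mem ha)
    have hpc := hp c (Finset.mem_insert_self c S)
    have hqc := hq c (Finset.mem_insert_self c S)
    rw [Finset.prod_insert hc, Finset.prod_insert hc, Finset.sum_insert hc,
      Finset.erase_insert hc]
    have herase : ∀ a ∈ S, ∏ b ∈ (insert c S).erase a, g b (τ a) =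
        g c (τ a) * ∏ b ∈ S.erase a, g b (τ a) := fun a ha => by
      rw [Finset.erase_insert_of_ne (show c ≠ a from fun h => hc (h ▸ ha)),
        Finset.prod_insert fun h => hc (Finset.mem_of_mem_erase h)]
    have hsum : (∑ a ∈ S, if p < τ a ∧ τ a < q then
        σ a * ∏ b ∈ (insert c S).erase a, g b (τ a) else 0) =
        ∑ a ∈ S, if p < τ a ∧ τ a < q then
          g c (τ a) * (σ a * ∏ b ∈ S.erase a, g b (τ a)) else 0 :=
      Finset.sum_congr rfl fun a ha => by rw [herase a ha, mul_left_comm]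
    rw [hsum]
    by_cases h : p < τ c ∧ τ c < q
    · have h1 := ih' p (τ c) h.1 hpS fun a ha => (hτc a ha).symm
      have h2 := ih' (τ c) q h.2 (fun a ha => (hτc a ha).symm) hqS
      have h3 := hg c p q hpq hpc hqc
      rw [if_pos h] at h3
      have h4 : (∑ a ∈ S, if p < τ a ∧ τ a < q then
          g c (τ a) * (σ a * ∏ b ∈ S.erase a, g b (τ a)) else 0) =
          g c p * (∏ a ∈ S, g a (τ c) - ∏ a ∈ S, g a p) +
            g c q * (∏ a ∈ S, g a q - ∏ a ∈ S, g a (τ c)) := by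
        rw [h1, h2, Finset.mul_sum, Finset.mul_sum, ← Finset.sum_add_distrib]
        refine Finset.sum_congr rfl fun a ha => ?_
        rcases lt_or_gt_of_ne (hτc a ha) with hlt | hlt
        · rw [if_neg fun h' : τ c < τ a ∧ τ a < q => lt_asymm hlt h'.1]
          by_cases hpa : p < τ a
          · have h5 := hg c p (τ a) hpa hpc (hτc a ha)
            rw [if_neg fun h' => lt_asymm hlt h'.2, sub_eq_zero] at h5
            rw [if_pos ⟨hpa, hlt.trans h.2⟩, if_pos ⟨hpa, hlt⟩, h5]
            ring
          · rw [if_neg fun h' => hpa h'.1, if_neg fun h' => hpa h'.1]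
            ring
        · rw [if_neg fun h' : p < τ a ∧ τ a < τ c => lt_asymm hlt h'.2]
          by_cases hqa : τ a < q
          · have h5 := hg c (τ a) q hqa (hτc a ha) hqc
            rw [if_neg fun h' => lt_asymm hlt h'.1, sub_eq_zero] at h5
            rw [if_pos ⟨h.1.trans hlt, hqa⟩, if_pos ⟨hlt, hqa⟩, h5]
            ring
          · rw [if_neg fun h' => hqa h'.2, if_neg fun h' => hqa h'.2]
            ring
      rw [if_pos h, h4, ← h3]
      ring
    · have h3 := hg c p q hpq hpc hqc
      rw [if_neg h, sub_eq_zero] at h3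
      rw [if_neg h, zero_add, h3, ← mul_sub, ih' p q hpq hpS hqS, Finset.mul_sum]
      refine Finset.sum_congr rfl fun a ha => ?_
      rw [mul_ite, mul_zero]
      refine if_ctx_congr Iff.rfl (fun h' => ?_) fun _ => rfl
      have h5 := hg c p (τ a) h'.1 hpc (hτc a ha)
      rw [if_neg fun h'' => h ⟨h''.1, h''.2.trans h'.2⟩, sub_eq_zero] at h5
      rw [h5]

theorem flip_congr {α β : ℝ} (t : ℝ) (h : 0 < α ↔ 0 < β) : flip α t = flip β t := by
  simp only [flip, h]

/-- `α + s β` changes sign only at `s = -α / β`, and the two branches of `flip` differ by exactly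
`1` whatever `t` is, so the jump is `sign β`. -/
theorem flip_add_mul_sub {α β : ℝ} (hβ : β ≠ 0) (t : ℝ) (p q : ℝ) (hpq : p < q)
    (hp : p ≠ -α / β) (hq : q ≠ -α / β) :
    flip (α + q * β) t - flip (α + p * β) t =
      if p < -α / β ∧ -α / β < q then Real.sign β else 0 := by
  set τ := -α / β with hτ
  have hα : α = -τ * β := by rw [hτ]; field_simp
  have hval : ∀ s, α + s * β = (s - τ) * β := fun s => by rw [hα]; ring
  rw [hval, hval]
  unfold flip
  rcases lt_or_gt_of_ne hβ with h | h
  · rw [Real.sign_of_neg h]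
    have hs : ∀ s, 0 < (s - τ) * β ↔ s < τ := fun s => by
      rw [mul_pos_iff]
      constructor
      · rintro (h' | h')
        · linarith [h'.2]
        · linarith [h'.1]
      · exact fun h' => Or.inr ⟨by linarith, h⟩
    simp only [hs]
    rcases lt_or_gt_of_ne hp with h1 | h1 <;> rcases lt_or_gt_of_ne hq with h2 | h2
    · simp [h1, h2, h2.le]
    · simp only [h1, h2, h2.not_gt, if_true, if_false, and_self]
      split_ifs <;> norm_num
    · linarith
    · simp [h1.not_gt, h2.not_gt]
  · rw [Real.sign_of_pos h]
    have hs : ∀ s, 0 < (s - τ) * β ↔ τ < s := fun s => by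
      rw [mul_pos_iff_of_pos_right h, sub_pos]
    simp only [hs]
    rcases lt_or_gt_of_ne hp with h1 | h1 <;> rcases lt_or_gt_of_ne hq with h2 | h2
    · simp [h1.not_gt, h2.not_gt]
    · simp only [h1, h2, h1.not_gt, if_true, if_false, and_self]
      split_ifs <;> norm_num
    · linarith
    · simp [h1, h2, h1.not_gt]

end StepFunctions

/-! ### Generic vectors, wall crossing and independence of the polarization -/

section Generic

variable {M : Type*} [Fintype M] {n : ℕ}

/-- Closedness in the form used for wall crossing; the weight `g` is split into its level sets, for
which `sum_eq_zero` applies. -/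
theorem SimplicialCycle.sum_mul_eq_zero (ω : SimplicialCycle M n) (a : Fin n)
    (g : (Fin n → M) → ℝ) (hg : ∀ J i, g (Function.update J a i) = g J) :
    ∑ J, ω.coeff J * g J = 0 := by
  classical
  have h : ∀ J, ω.coeff J * g J =
      ∑ r ∈ Finset.univ.image g, r * (if g J = r then ω.coeff J else 0) := fun J => by
    rw [Finset.sum_eq_single (g J)]
    · simp [mul_comm]
    · intro r _ hr
      simp [hr.symm]
    · simp
  simp only [h]
  rw [Finset.sum_comm]
  refine Finset.sum_eq_zero fun r _ => ?_
  rw [← Finset.mul_sum, ω.sum_eq_zero a (fun J => g J = r) fun J i => by rw [hg], mul_zero]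

namespace MultiFan

variable (Δ : MultiFan M n)

theorem det_ne_zero {I : Fin n → M} (hI : Δ.cycle.coeff I ≠ 0) : (Δ.rayMatrix I).det ≠ 0 := by
  have h := (Matrix.linearIndependent_rows_iff_isUnit (A := Δ.rayMatrix I)).1 (Δ.basis I hI)
  exact ((Matrix.isUnit_iff_isUnit_det _).1 h).ne_zero

theorem coord_vecMul {I : Fin n → M} (hI : Δ.cycle.coeff I ≠ 0) (v : Fin n → ℝ) :
    Matrix.vecMul (Δ.coord v I) (Δ.rayMatrix I) = v := by
  rw [coord, Matrix.vecMul_vecMul, Matrix.nonsing_inv_mul _ (Δ.det_ne_zero hI).isUnit,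
    Matrix.vecMul_one]

theorem coord_ray {I : Fin n → M} (hI : Δ.cycle.coeff I ≠ 0) (a : Fin n) :
    Δ.coord (Δ.ray (I a)) I = Pi.single a 1 := by
  have h : Δ.ray (I a) = Matrix.vecMul (Pi.single a 1) (Δ.rayMatrix I) := by
    rw [Matrix.single_one_vecMul]
    rfl
  rw [coord, h, Matrix.vecMul_vecMul, Matrix.mul_nonsing_inv _ (Δ.det_ne_zero hI).isUnit,
    Matrix.vecMul_one]

theorem sum_coord_mul {I : Fin n → M} (hI : Δ.cycle.coeff I ≠ 0) (u v : Fin n → ℝ) :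
    ∑ a, Δ.coord v I a * (u ⬝ᵥ Δ.ray (I a)) = u ⬝ᵥ v := by
  conv_rhs => rw [← Δ.coord_vecMul hI v, dotProduct_comm, ← Matrix.dotProduct_mulVec]
  refine Finset.sum_congr rfl fun a _ => ?_
  rw [dotProduct_comm]
  rfl

/-- Cramer's rule. -/
theorem coord_mul_det {I : Fin n → M} (hI : Δ.cycle.coeff I ≠ 0) (v : Fin n → ℝ) (a : Fin n) :
    Δ.coord v I a * (Δ.rayMatrix I).det = ((Δ.rayMatrix I).updateRow a v).det := by
  have h := Matrix.det_updateRow_sum (Δ.rayMatrix I) a (Δ.coord v I)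
  rw [smul_eq_mul] at h
  rw [← h]
  congr 2
  conv_rhs => rw [← Δ.coord_vecMul hI v]
  funext b
  simp [Matrix.vecMul, dotProduct]

/-- The `a`-th coordinate in the basis `λ(I)` as a linear functional. -/
noncomputable def coordDual (I : Fin n → M) (a : Fin n) : Module.Dual ℝ (Fin n → ℝ) :=
  (LinearMap.proj a).comp (Matrix.vecMulLinear (Δ.rayMatrix I)⁻¹)

theorem coordDual_apply (I : Fin n → M) (a : Fin n) (v : Fin n → ℝ) :
    Δ.coordDual I a v = Δ.coord v I a := rfl

/-- There are generic vectors which moreover avoid the zeros of finitely many functionals. -/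
theorem exists_isGeneric_and {κ : Type*} [Finite κ] (f : κ → Module.Dual ℝ (Fin n → ℝ))
    (hf : ∀ i, f i ≠ 0) : ∃ v, Δ.IsGeneric v ∧ ∀ i, f i v ≠ 0 := by
  obtain ⟨v, hv⟩ := Module.Dual.exists_forall_ne_zero_of_forall_exists
    (Sum.elim (fun p : {I // Δ.cycle.coeff I ≠ 0} × Fin n => Δ.coordDual p.1 p.2) f) (by
      rintro (⟨⟨I, hI⟩, a⟩ | i)
      · refine ⟨Δ.ray (I a), ?_⟩
        simp [coordDual_apply, coord_ray Δ hI]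
      · exact DFunLike.ne_iff.1 (hf i))
  exact ⟨v, fun I hI a => hv (Sum.inl (⟨I, hI⟩, a)), fun i => hv (Sum.inr i)⟩

theorem exists_isGeneric_isGeneric {N : Type*} [Fintype N] (Δ₁ : MultiFan N n) :
    ∃ v, Δ.IsGeneric v ∧ Δ₁.IsGeneric v := by
  obtain ⟨v, hv, hv'⟩ := Δ.exists_isGeneric_and
    (fun p : {I // Δ₁.cycle.coeff I ≠ 0} × Fin n => Δ₁.coordDual p.1 p.2) (by
      rintro ⟨⟨I, hI⟩, a⟩ h
      have := DFunLike.congr_fun h (Δ₁.ray (I a))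
      simp [coordDual_apply, coord_ray Δ₁ hI] at this)
  exact ⟨v, hv, fun I hI a => hv' (⟨I, hI⟩, a)⟩

theorem exists_isGeneric : ∃ v, Δ.IsGeneric v :=
  let ⟨v, hv, _⟩ := Δ.exists_isGeneric_isGeneric Δ
  ⟨v, hv⟩

theorem coord_neg (v : Fin n → ℝ) (I : Fin n → M) (a : Fin n) :
    Δ.coord (-v) I a = -Δ.coord v I a := by
  simp [coord, Matrix.neg_vecMul]

variable {Δ} in
theorem IsGeneric.neg {v : Fin n → ℝ} (hv : Δ.IsGeneric v) : Δ.IsGeneric (-v) :=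
  fun I hI a => by
    rw [coord_neg, neg_ne_zero]
    exact hv I hI a

/-- Two vectors whose coordinate ratios in every basis `λ(I)` are distinct. -/
def IsTransverse (v w : Fin n → ℝ) : Prop :=
  ∀ I, Δ.cycle.coeff I ≠ 0 → ∀ a b, a ≠ b →
    Δ.coord v I a * Δ.coord w I b ≠ Δ.coord v I b * Δ.coord w I a

variable {Δ} in
theorem IsTransverse.symm {v w : Fin n → ℝ} (h : Δ.IsTransverse v w) : Δ.IsTransverse w v :=
  fun I hI a b hab h' => h I hI a b hab (by linarith)

theorem exists_isGeneric_isTransverse {v w : Fin n → ℝ} (hv : Δ.IsGeneric v)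
    (hw : Δ.IsGeneric w) : ∃ z, Δ.IsGeneric z ∧ Δ.IsTransverse v z ∧ Δ.IsTransverse w z := by
  let f : (Fin n → ℝ) → {I // Δ.cycle.coeff I ≠ 0} × {p : Fin n × Fin n // p.1 ≠ p.2} →
      Module.Dual ℝ (Fin n → ℝ) := fun v p =>
    Δ.coord v p.1 p.2.1.1 • Δ.coordDual p.1 p.2.1.2 - Δ.coord v p.1 p.2.1.2 • Δ.coordDual p.1 p.2.1.1
  have hf : ∀ v, Δ.IsGeneric v → ∀ p, f v p ≠ 0 := by
    rintro v hv ⟨⟨I, hI⟩, ⟨⟨a, b⟩, hab⟩⟩ h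
    -- At `λ(I b)` the functional takes the value `α_{I,a}(v)`, nonzero by genericity.
    have := DFunLike.congr_fun h (Δ.ray (I b))
    simp [f, coordDual_apply, coord_ray Δ hI, show a ≠ b from hab] at this
    exact hv I hI a this
  obtain ⟨z, hz, hz'⟩ := Δ.exists_isGeneric_and (Sum.elim (f v) (f w))
    (by rintro (p | p); exacts [hf v hv p, hf w hw p])
  refine ⟨z, hz, fun I hI a b hab h => ?_, fun I hI a b hab h => ?_⟩
  · exact hz' (Sum.inl (⟨I, hI⟩, ⟨(a, b), hab⟩)) (sub_eq_zero.2 h)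
  · exact hz' (Sum.inr (⟨I, hI⟩, ⟨(a, b), hab⟩)) (sub_eq_zero.2 h)

/-- The jump of the Duistermaat–Heckman function when the polarization vector moves on the ray
from `v` in direction `w` through the hyperplane spanned by `λ(I b)`, `b ≠ a`. -/
noncomputable def wallJump (v w : Fin n → ℝ) (c : M → ℝ) (u : Fin n → ℝ) (a : Fin n)
    (I : Fin n → M) : ℝ :=
  let R := (Δ.rayMatrix I).updateRow a w
  let τ := -((Δ.rayMatrix I).updateRow a v).det / R.det
  if 0 < τ then
    Real.sign R.det * ∏ b ∈ Finset.univ.erase a,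
      flip (Matrix.vecMul (v + τ • w) R⁻¹ b) (u ⬝ᵥ Δ.ray (I b) - c (I b))
  else 0

/-- The vertex `I a` enters only through row `a`, which is overwritten, and through the factor `b =
a`, which is omitted. Summation over `I a` against a cycle therefore gives zero. -/
theorem wallJump_update (v w : Fin n → ℝ) (c : M → ℝ) (u : Fin n → ℝ) (a : Fin n)
    (I : Fin n → M) (i : M) :
    Δ.wallJump v w c u a (Function.update I a i) = Δ.wallJump v w c u a I := by
  have h : ∀ z, (Δ.rayMatrix (Function.update I a i)).updateRow a z =
      (Δ.rayMatrix I).updateRow a z := by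
    intro z
    ext b d
    by_cases hb : b = a
    · subst hb; simp
    · simp [rayMatrix, hb]
  simp only [wallJump, h]
  refine if_ctx_congr Iff.rfl (fun _ => ?_) fun _ => rfl
  congr 1
  refine Finset.prod_congr rfl fun b hb => ?_
  rw [Function.update_of_ne (Finset.ne_of_mem_erase hb)]

/-- Move along `v + s w` from `s = 0` to a large `s = q`. The coordinates vanish at the times `τ a`,
distinct by transversality, so the factors jump one at a time. Cramer's rule rewrites each jump
without reference to `I a`. -/
theorem sign_det_mul_prod_sub {v w : Fin n → ℝ} (hw : Δ.IsGeneric w) (hv : Δ.IsGeneric v)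
    (hvw : Δ.IsTransverse v w) (c : M → ℝ) (u : Fin n → ℝ) {I : Fin n → M}
    (hI : Δ.cycle.coeff I ≠ 0) :
    Real.sign (Δ.rayMatrix I).det * (∏ a, flip (Δ.coord w I a) (u ⬝ᵥ Δ.ray (I a) - c (I a)) -
      ∏ a, flip (Δ.coord v I a) (u ⬝ᵥ Δ.ray (I a) - c (I a))) =
      ∑ a, Δ.wallJump v w c u a I := by
  have hdet := Δ.det_ne_zero hI
  set α := Δ.coord v I with hα
  set β := Δ.coord w I with hβ
  set t : Fin n → ℝ := fun a => u ⬝ᵥ Δ.ray (I a) - c (I a)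
  have hα0 : ∀ a, α a ≠ 0 := hv I hI
  have hβ0 : ∀ a, β a ≠ 0 := hw I hI
  set τ : Fin n → ℝ := fun a => -α a / β a with hτ
  have hτ0 : ∀ a, τ a ≠ 0 := fun a => div_ne_zero (neg_ne_zero.2 (hα0 a)) (hβ0 a)
  have hτinj : ∀ a b, a ≠ b → τ a ≠ τ b := fun a b hab h => by
    have h' := (div_eq_div_iff (hβ0 a) (hβ0 b)).1 h
    exact hvw I hI a b hab (by linarith)
  -- Past all the `τ a`, the coordinates of `v + q w` have the signs of those of `w`.
  obtain ⟨q, hq0, hq⟩ : ∃ q, 0 < q ∧ ∀ a, |τ a| < q := by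
    refine ⟨1 + ∑ a, |τ a|, by positivity, fun a => ?_⟩
    have := Finset.single_le_sum (f := fun a => |τ a|) (fun a _ => abs_nonneg (τ a))
      (Finset.mem_univ a)
    linarith
  have hτq : ∀ a, τ a < q := fun a => (le_abs_self _).trans_lt (hq a)
  have hstep := prod_step_sub_prod_step (fun a s => flip (α a + s * β a) (t a)) τ
    (fun a => Real.sign (β a)) (fun a p q hpq hp hq => flip_add_mul_sub (hβ0 a) (t a) p q hpq hp hq)
    Finset.univ (fun a _ b _ => hτinj a b) 0 q hq0 (fun a _ => (hτ0 a).symm)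
    (fun a _ => (hτq a).ne')
  have hflipq : ∀ a, flip (α a + q * β a) (t a) = flip (β a) (t a) := fun a => by
    refine flip_congr _ ?_
    have h1 : α a + q * β a = (q - τ a) * β a := by
      simp only [hτ]
      have := hβ0 a
      field_simp
      ring
    rw [h1, mul_pos_iff_of_pos_left (sub_pos.2 (hτq a))]
  simp only [hflipq, zero_mul, add_zero] at hstep
  rw [hstep, Finset.mul_sum]
  refine Finset.sum_congr rfl fun a _ => ?_
  have hdv := Δ.coord_mul_det hI v a
  have hdw := Δ.coord_mul_det hI w a
  rw [← hα] at hdv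
  rw [← hβ] at hdw
  have hτa : -((Δ.rayMatrix I).updateRow a v).det / ((Δ.rayMatrix I).updateRow a w).det = τ a := by
    rw [← hdv, ← hdw, ← neg_mul, mul_div_mul_right _ _ hdet]
  unfold wallJump
  simp only [hτa, hτq, and_true, mul_ite, mul_zero]
  refine if_ctx_congr Iff.rfl (fun _ => ?_) fun _ => rfl
  rw [← mul_assoc]
  have hsign : Real.sign (Δ.rayMatrix I).det * Real.sign (β a) =
      Real.sign ((Δ.rayMatrix I).updateRow a w).det := by
    rw [← hdw]
    rcases lt_or_gt_of_ne (hβ0 a) with h1 | h1 <;> rcases lt_or_gt_of_ne hdet with h2 | h2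
    · rw [Real.sign_of_neg h1, Real.sign_of_neg h2, Real.sign_of_pos (mul_pos_of_neg_of_neg h1 h2)]
      norm_num
    · rw [Real.sign_of_neg h1, Real.sign_of_pos h2, Real.sign_of_neg (mul_neg_of_neg_of_pos h1 h2)]
      norm_num
    · rw [Real.sign_of_pos h1, Real.sign_of_neg h2, Real.sign_of_neg (mul_neg_of_pos_of_neg h1 h2)]
      norm_num
    · rw [Real.sign_of_pos h1, Real.sign_of_pos h2, Real.sign_of_pos (mul_pos h1 h2)]
      norm_num
  rw [hsign]
  congr 1
  refine Finset.prod_congr rfl fun b hb => ?_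
  have hR : IsUnit ((Δ.rayMatrix I).updateRow a w).det := by
    rw [← hdw]
    exact (mul_ne_zero (hβ0 a) hdet).isUnit
  -- At time `τ a` the coordinate at `a` vanishes, so replacing row `a` by `w` leaves the
  -- combination unchanged.
  have hvec : Matrix.vecMul (α + τ a • β) ((Δ.rayMatrix I).updateRow a w) = v + τ a • w := by
    have hz : (α + τ a • β) a = 0 := by
      simp only [Pi.add_apply, Pi.smul_apply, smul_eq_mul, hτ]
      have := hβ0 a
      field_simp
      ring
    conv_rhs => rw [← Δ.coord_vecMul hI v, ← Δ.coord_vecMul hI w, ← Matrix.smul_vecMul,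
      ← Matrix.add_vecMul]
    funext d
    simp only [Matrix.vecMul, dotProduct]
    refine Finset.sum_congr rfl fun e _ => ?_
    by_cases he : e = a
    · subst he
      rw [← hα, ← hβ, hz, zero_mul, zero_mul]
    · rw [Matrix.updateRow_ne he]
  have hcoord : Matrix.vecMul (v + τ a • w) ((Δ.rayMatrix I).updateRow a w)⁻¹ = α + τ a • β := by
    rw [← hvec, Matrix.vecMul_vecMul, Matrix.mul_nonsing_inv _ hR, Matrix.vecMul_one]
  rw [hcoord]
  rfl

theorem dhFunction_eq_of_isTransverse {v w : Fin n → ℝ} (hv : Δ.IsGeneric v) (hw : Δ.IsGeneric w)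
    (hvw : Δ.IsTransverse v w) (c : M → ℝ) (u : Fin n → ℝ) :
    Δ.dhFunction w c u = Δ.dhFunction v c u := by
  rw [← sub_eq_zero, dhFunction, dhFunction, ← mul_sub, ← Finset.sum_sub_distrib]
  have h : ∀ I, Δ.cycle.coeff I * Real.sign (Δ.rayMatrix I).det *
      ∏ a, flip (Δ.coord w I a) (u ⬝ᵥ Δ.ray (I a) - c (I a)) -
      Δ.cycle.coeff I * Real.sign (Δ.rayMatrix I).det *
      ∏ a, flip (Δ.coord v I a) (u ⬝ᵥ Δ.ray (I a) - c (I a)) =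
      ∑ a, Δ.cycle.coeff I * Δ.wallJump v w c u a I := fun I => by
    by_cases hI : Δ.cycle.coeff I = 0
    · simp [hI]
    · rw [← Finset.mul_sum, ← Δ.sign_det_mul_prod_sub hw hv hvw c u hI]
      ring
  simp only [h]
  rw [Finset.sum_comm, Finset.sum_eq_zero, mul_zero]
  intro a _
  exact Δ.cycle.sum_mul_eq_zero a _ fun J i => Δ.wallJump_update v w c u a J i

/-- The Duistermaat–Heckman function does not depend on the polarization vector. -/
theorem dhFunction_eq {v w : Fin n → ℝ} (hv : Δ.IsGeneric v) (hw : Δ.IsGeneric w) (c : M → ℝ)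
    (u : Fin n → ℝ) : Δ.dhFunction v c u = Δ.dhFunction w c u := by
  obtain ⟨z, hz, hvz, hwz⟩ := Δ.exists_isGeneric_isTransverse hv hw
  rw [← Δ.dhFunction_eq_of_isTransverse hv hz hvz, Δ.dhFunction_eq_of_isTransverse hw hz hwz]

end MultiFan

end Generic

/-! ### Small-time asymptotics of exponential sums -/

section Asymptotics

open MeasureTheory Filter Topology

/-- If `∑ q e^{t x} ~ L t^n` for `t → 0+`, then `L` is the coefficient of `t^n`. -/
theorem eq_sum_of_tendsto_sum_exp_div {κ : Type*} (s : Finset κ) (q x : κ → ℝ) (n : ℕ) (L : ℝ)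
    (h : Tendsto (fun t : ℝ => (∑ i ∈ s, q i * Real.exp (t * x i)) / t ^ n) (𝓝[>] 0) (𝓝 L)) :
    L = (∑ i ∈ s, q i * x i ^ n) / n.factorial := by
  set g : ℝ → ℝ := fun t => ∑ i ∈ s, q i * Real.exp (t * x i)
  set S : ℕ → ℝ := fun j => ∑ i ∈ s, q i * x i ^ j with hS
  have hlim : ∀ j : ℕ, (∀ i < j, S i = 0) →
      Tendsto (fun t => g t / t ^ j) (𝓝[>] 0) (𝓝 (S j / j.factorial)) := by
    intro j hj
    have h1 : ∀ i, (fun t : ℝ => Real.exp (t * x i) -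
        ∑ l ∈ Finset.range (j + 1), (t * x i) ^ l / l.factorial) =o[𝓝[>] 0] fun t : ℝ => t ^ j := by
      intro i
      have ht : Tendsto (fun t : ℝ => t * x i) (𝓝[>] 0) (𝓝 0) := by
        have : Tendsto (fun t : ℝ => t * x i) (𝓝 0) (𝓝 (0 * x i)) := tendsto_id.mul_const _
        rw [zero_mul] at this
        exact this.mono_left nhdsWithin_le_nhds
      have h2 := (Real.exp_sub_sum_range_succ_isLittleO_pow j).comp_tendsto ht
      refine h2.trans_isBigO ?_
      have h3 : ((fun t : ℝ => t ^ j) ∘ fun t : ℝ => t * x i) = fun t => x i ^ j * t ^ j := by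
        funext t
        simp only [Function.comp_apply, mul_pow, mul_comm]
      rw [h3]
      exact Asymptotics.isBigO_const_mul_self _ _ _
    have h2 : (fun t => g t - S j / j.factorial * t ^ j) =o[𝓝[>] 0] fun t : ℝ => t ^ j := by
      have h3 : (fun t => g t - S j / j.factorial * t ^ j) = fun t => ∑ i ∈ s, q i *
          (Real.exp (t * x i) - ∑ l ∈ Finset.range (j + 1), (t * x i) ^ l / l.factorial) := by
        funext t
        simp only [mul_sub, Finset.sum_sub_distrib, Finset.mul_sum, g]
        rw [Finset.sum_comm (s := s)]
        have h4 : ∀ l, ∑ i ∈ s, q i * ((t * x i) ^ l / l.factorial) =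
            S l / l.factorial * t ^ l := fun l => by
          rw [hS, Finset.sum_div, Finset.sum_mul]
          exact Finset.sum_congr rfl fun i _ => by rw [mul_pow]; ring
        simp only [h4]
        rw [Finset.sum_range_succ, Finset.sum_eq_zero (s := Finset.range j) fun l hl => by
          rw [hj l (Finset.mem_range.1 hl), zero_div, zero_mul], zero_add]
      rw [h3]
      exact Asymptotics.IsLittleO.fun_sum fun i _ => (h1 i).const_mul_left _
    have h5 := h2.tendsto_div_nhds_zero.add_const (S j / j.factorial)
    rw [zero_add] at h5
    refine h5.congr' ?_
    filter_upwards [self_mem_nhdsWithin] with t ht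
    have : t ^ j ≠ 0 := pow_ne_zero _ (ne_of_gt ht)
    field_simp
    ring
  -- If the moments below `j` vanish, `g t / t ^ j` tends to `S j / j!`; but it equals `(g t / t ^
  -- n) * t ^ (n - j)`, which tends to `0`.
  have hzero : ∀ j < n, S j = 0 := by
    intro j
    induction j using Nat.strong_induction_on with
    | _ j ih =>
      intro hj
      have h1 := hlim j fun i hi => ih i hi (hi.trans hj)
      have h2 : Tendsto (fun t : ℝ => g t / t ^ j) (𝓝[>] 0) (𝓝 (L * 0)) := by
        have h3 : Tendsto (fun t : ℝ => t ^ (n - j)) (𝓝[>] 0) (𝓝 0) := by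
          have : Tendsto (fun t : ℝ => t ^ (n - j)) (𝓝 0) (𝓝 (0 ^ (n - j))) :=
            tendsto_id.pow _
          rw [zero_pow (by omega)] at this
          exact this.mono_left nhdsWithin_le_nhds
        refine (h.mul h3).congr' ?_
        filter_upwards [self_mem_nhdsWithin] with t ht
        have ht' : t ≠ 0 := ne_of_gt ht
        rw [div_mul_eq_mul_div, div_eq_div_iff (pow_ne_zero _ ht') (pow_ne_zero _ ht'), mul_assoc,
          ← pow_add, Nat.sub_add_cancel hj.le]
      have h3 := tendsto_nhds_unique h1 h2
      rw [mul_zero, div_eq_zero_iff] at h3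
      exact h3.resolve_right (by positivity)
  exact tendsto_nhds_unique h (hlim n hzero)

end Asymptotics

/-! ### Laplace transforms of flipped orthants -/

section Laplace

open MeasureTheory Filter Topology

theorem measurable_flip (α : ℝ) : Measurable (flip α) := by
  unfold flip
  split_ifs <;>
  exact Measurable.ite measurableSet_Iic measurable_const measurable_const

theorem abs_flip_le (α t : ℝ) : |flip α t| ≤ 1 := by
  unfold flip
  split_ifs <;> simp

theorem flip_sub_mul_exp {α : ℝ} (c s y : ℝ) :
    flip α (y - c) * Real.exp (s * y) =
      if 0 < α then (Set.Iic c).indicator (fun y => Real.exp (s * y)) y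
      else -(Set.Ioi c).indicator (fun y => Real.exp (s * y)) y := by
  unfold flip
  simp only [sub_nonpos, Set.indicator_apply, Set.mem_Iic, Set.mem_Ioi]
  by_cases h : 0 < α <;> by_cases h' : y ≤ c
  · simp [h, h']
  · simp [h, h']
  · simp [h, h', h'.not_gt]
  · simp [h, h', not_le.1 h']

theorem integrable_flip_mul_exp {α t : ℝ} (hα : α ≠ 0) (ht : 0 < t) (c : ℝ) :
    Integrable fun y => flip α (y - c) * Real.exp (t * α * y) := by
  simp only [flip_sub_mul_exp]
  by_cases h : 0 < α
  · simp only [h, if_true]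
    exact (integrable_indicator_iff measurableSet_Iic).2
      (integrableOn_exp_mul_Iic (mul_pos ht h) c)
  · simp only [h, if_false]
    exact ((integrable_indicator_iff measurableSet_Ioi).2 (integrableOn_exp_mul_Ioi
      (mul_neg_of_pos_of_neg ht (lt_of_le_of_ne (not_lt.1 h) hα)) c)).neg

/-- The sign `-1` on the flipped half-line is what makes both cases yield the same expression in
`α`. -/
theorem integral_flip_mul_exp {α t : ℝ} (hα : α ≠ 0) (ht : 0 < t) (c : ℝ) :
    ∫ y, flip α (y - c) * Real.exp (t * α * y) = Real.exp (t * (α * c)) / (t * α) := by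
  simp only [flip_sub_mul_exp]
  by_cases h : 0 < α
  · simp only [h, if_true]
    rw [integral_indicator measurableSet_Iic, integral_exp_mul_Iic (mul_pos ht h), mul_assoc]
  · simp only [h, if_false]
    rw [integral_neg, integral_indicator measurableSet_Ioi, integral_exp_mul_Ioi
      (mul_neg_of_pos_of_neg ht (lt_of_le_of_ne (not_lt.1 h) hα)), mul_assoc, neg_div, neg_neg]

/-- The Laplace kernel of a flipped orthant with apex `c`. -/
noncomputable def flipExp {n : ℕ} (α c : Fin n → ℝ) (t : ℝ) (y : Fin n → ℝ) : ℝ :=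
  ∏ a, flip (α a) (y a - c a) * Real.exp (t * α a * y a)

theorem integrable_flipExp {n : ℕ} {α : Fin n → ℝ} (hα : ∀ a, α a ≠ 0) (c : Fin n → ℝ) {t : ℝ}
    (ht : 0 < t) : Integrable (flipExp α c t) :=
  Integrable.fintype_prod (f := fun a y => flip (α a) (y - c a) * Real.exp (t * α a * y))
    fun a => integrable_flip_mul_exp (hα a) ht _

theorem integral_flipExp {n : ℕ} {α : Fin n → ℝ} (hα : ∀ a, α a ≠ 0) (c : Fin n → ℝ) {t : ℝ}
    (ht : 0 < t) : ∫ y, flipExp α c t y = Real.exp (t * ∑ a, α a * c a) / (t ^ n * ∏ a, α a) := by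
  unfold flipExp
  rw [integral_fintype_prod_volume_eq_prod
    (fun a y => flip (α a) (y - c a) * Real.exp (t * α a * y))]
  simp only [integral_flip_mul_exp (hα _) ht]
  rw [Finset.prod_div_distrib, ← Real.exp_sum, ← Finset.mul_sum, Finset.prod_mul_distrib,
    Finset.prod_const, Finset.card_univ, Fintype.card_fin]

end Laplace

/-! ### Bounded support and Lawrence's formula -/

section Volume

open MeasureTheory Filter Topology

namespace MultiFan

variable {M : Type*} [Fintype M] {n : ℕ} (Δ : MultiFan M n)

theorem rayMatrix_mulVec (I : Fin n → M) (u : Fin n → ℝ) (a : Fin n) :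
    Matrix.toLin' (Δ.rayMatrix I) u a = u ⬝ᵥ Δ.ray (I a) := by
  rw [Matrix.toLin'_apply, dotProduct_comm]
  rfl

/-- In the coordinates `y_a = ⟨u, λ(I a)⟩` one has `⟨u, v⟩ = ∑ α_a y_a`, so the kernel splits as a
product over the axes. -/
theorem prod_flip_mul_exp_eq {v : Fin n → ℝ} {I : Fin n → M} (hI : Δ.cycle.coeff I ≠ 0)
    (c : M → ℝ) (t : ℝ) :
    (fun u : Fin n → ℝ => (∏ a, flip (Δ.coord v I a) (u ⬝ᵥ Δ.ray (I a) - c (I a))) *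
        Real.exp (t * (u ⬝ᵥ v))) =
      flipExp (Δ.coord v I) (c ∘ I) t ∘ Matrix.toLin' (Δ.rayMatrix I) := by
  funext u
  simp only [flipExp, Function.comp_apply, rayMatrix_mulVec]
  rw [Finset.prod_mul_distrib, ← Real.exp_sum, ← Δ.sum_coord_mul hI, Finset.mul_sum]
  simp only [mul_assoc]

theorem map_rayMatrix {I : Fin n → M} (hI : Δ.cycle.coeff I ≠ 0) :
    Measure.map (Matrix.toLin' (Δ.rayMatrix I)) MeasureTheory.volume =
      ENNReal.ofReal |(Δ.rayMatrix I).det⁻¹| • (MeasureTheory.volume : Measure (Fin n → ℝ)) :=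
  Real.map_matrix_volume_pi_eq_smul_volume_pi (Δ.det_ne_zero hI)

theorem measurable_toLin' (R : Matrix (Fin n) (Fin n) ℝ) : Measurable (Matrix.toLin' R) :=
  (LinearMap.continuous_of_finiteDimensional _).measurable

theorem integrable_prod_flip_mul_exp {v : Fin n → ℝ} (hv : Δ.IsGeneric v) {I : Fin n → M}
    (hI : Δ.cycle.coeff I ≠ 0) (c : M → ℝ) {t : ℝ} (ht : 0 < t) :
    Integrable fun u : Fin n → ℝ =>
      (∏ a, flip (Δ.coord v I a) (u ⬝ᵥ Δ.ray (I a) - c (I a))) * Real.exp (t * (u ⬝ᵥ v)) := by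
  rw [Δ.prod_flip_mul_exp_eq hI]
  refine Integrable.comp_measurable ?_ (measurable_toLin' _)
  rw [Δ.map_rayMatrix hI]
  exact (integrable_flipExp (hv I hI) _ ht).smul_measure ENNReal.ofReal_ne_top

theorem integral_prod_flip_mul_exp {v : Fin n → ℝ} (hv : Δ.IsGeneric v) {I : Fin n → M}
    (hI : Δ.cycle.coeff I ≠ 0) (c : M → ℝ) {t : ℝ} (ht : 0 < t) :
    ∫ u : Fin n → ℝ, (∏ a, flip (Δ.coord v I a) (u ⬝ᵥ Δ.ray (I a) - c (I a))) *
        Real.exp (t * (u ⬝ᵥ v)) =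
      |(Δ.rayMatrix I).det|⁻¹ * (Real.exp (t * ∑ a, Δ.coord v I a * c (I a)) /
        (t ^ n * ∏ a, Δ.coord v I a)) := by
  have hF := integrable_flipExp (hv I hI) (c ∘ I) ht
  rw [Δ.prod_flip_mul_exp_eq hI]
  change ∫ u, flipExp (Δ.coord v I) (c ∘ I) t (Matrix.toLin' (Δ.rayMatrix I) u) = _
  rw [← integral_map (f := flipExp (Δ.coord v I) (c ∘ I) t) (measurable_toLin' _).aemeasurable (by
    rw [Δ.map_rayMatrix hI]
    exact (hF.smul_measure ENNReal.ofReal_ne_top).1), Δ.map_rayMatrix hI, integral_smul_measure,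
    integral_flipExp (hv I hI) _ ht, ENNReal.toReal_ofReal (abs_nonneg _), smul_eq_mul, abs_inv]
  rfl

/-- On the flipped cone of `I`, `α_a ⟨u, λ(I a)⟩ ≤ α_a c_{I a}` for either sign of `α_a`; add over
`a`. Summing absolute values over all `I` makes the bound uniform. -/
theorem dotProduct_le_of_dhFunction_ne_zero {v : Fin n → ℝ} (c : M → ℝ)
    {u : Fin n → ℝ} (hu : Δ.dhFunction v c u ≠ 0) :
    u ⬝ᵥ v ≤ ∑ I : Fin n → M, |∑ a, Δ.coord v I a * c (I a)| := by
  obtain ⟨I, -, h⟩ := Finset.exists_ne_zero_of_sum_ne_zero (right_ne_zero_of_mul hu)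
  have hI : Δ.cycle.coeff I ≠ 0 := left_ne_zero_of_mul (left_ne_zero_of_mul h)
  have hprod := right_ne_zero_of_mul h
  have hle : ∀ a, Δ.coord v I a * (u ⬝ᵥ Δ.ray (I a)) ≤ Δ.coord v I a * c (I a) := fun a => by
    have h1 := Finset.prod_ne_zero_iff.1 hprod a (Finset.mem_univ a)
    unfold flip at h1
    split_ifs at h1 with h2 h3 h3
    · exact mul_le_mul_of_nonneg_left (sub_nonpos.1 h3) h2.le
    · exact absurd rfl h1
    · exact absurd rfl h1
    · exact mul_le_mul_of_nonpos_left (sub_nonneg.1 (not_le.1 h3).le) (not_lt.1 h2)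
  rw [← Δ.sum_coord_mul hI]
  refine (Finset.sum_le_sum fun a _ => hle a).trans ((le_abs_self _).trans ?_)
  exact Finset.single_le_sum (f := fun I : Fin n → M => |∑ a, Δ.coord v I a * c (I a)|)
    (fun I _ => abs_nonneg _) (Finset.mem_univ I)

/-- Independence of the polarization allows both `w` and `-w` to be used for any generic `w`, giving
a two-sided bound; generic vectors span. -/
theorem exists_abs_dotProduct_le {v : Fin n → ℝ} (hv : Δ.IsGeneric v) (c : M → ℝ)
    (x : Fin n → ℝ) : ∃ B, ∀ u, Δ.dhFunction v c u ≠ 0 → |u ⬝ᵥ x| ≤ B := by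
  have hspan : Submodule.span ℝ {w | Δ.IsGeneric w} = ⊤ := by
    by_contra h
    obtain ⟨f, hf, hle⟩ := Submodule.exists_le_ker_of_lt_top _ (lt_top_iff_ne_top.2 h)
    obtain ⟨w, hw, hfw⟩ := Δ.exists_isGeneric_and (fun _ : Unit => f) fun _ => hf
    exact hfw () (hle (Submodule.subset_span hw))
  have hx : x ∈ Submodule.span ℝ {w | Δ.IsGeneric w} := hspan ▸ Submodule.mem_top
  induction hx using Submodule.span_induction with
  | mem w hw =>
    have hw : Δ.IsGeneric w := hw
    refine ⟨max (∑ I : Fin n → M, |∑ a, Δ.coord w I a * c (I a)|)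
      (∑ I : Fin n → M, |∑ a, Δ.coord (-w) I a * c (I a)|), fun u hu => abs_le'.2 ⟨?_, ?_⟩⟩
    · refine le_max_of_le_left (Δ.dotProduct_le_of_dhFunction_ne_zero c ?_)
      rwa [← Δ.dhFunction_eq hv hw]
    · rw [← dotProduct_neg]
      refine le_max_of_le_right (Δ.dotProduct_le_of_dhFunction_ne_zero c ?_)
      rwa [← Δ.dhFunction_eq hv hw.neg]
  | zero => exact ⟨0, fun u _ => by simp⟩
  | add y z _ _ hy hz =>
    obtain ⟨B₁, h₁⟩ := hy
    obtain ⟨B₂, h₂⟩ := hz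
    refine ⟨B₁ + B₂, fun u hu => ?_⟩
    rw [dotProduct_add]
    exact (abs_add_le _ _).trans (add_le_add (h₁ u hu) (h₂ u hu))
  | smul r y _ hy =>
    obtain ⟨B, h⟩ := hy
    refine ⟨|r| * B, fun u hu => ?_⟩
    rw [dotProduct_smul, smul_eq_mul, abs_mul]
    exact mul_le_mul_of_nonneg_left (h u hu) (abs_nonneg r)

theorem measurable_dhFunction (v : Fin n → ℝ) (c : M → ℝ) : Measurable (Δ.dhFunction v c) := by
  unfold dhFunction
  refine Measurable.const_mul (Finset.measurable_sum _ fun I _ =>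
    Measurable.const_mul (Finset.measurable_prod _ fun a _ =>
      (measurable_flip _).comp ?_) _) _
  simp only [dotProduct]
  fun_prop

theorem exists_abs_dhFunction_le (v : Fin n → ℝ) (c : M → ℝ) :
    ∃ K, ∀ u, |Δ.dhFunction v c u| ≤ K := by
  refine ⟨(n.factorial : ℝ)⁻¹ * ∑ I : Fin n → M,
    |Δ.cycle.coeff I * Real.sign (Δ.rayMatrix I).det|, fun u => ?_⟩
  rw [dhFunction, abs_mul, abs_of_nonneg (by positivity : (0 : ℝ) ≤ (n.factorial : ℝ)⁻¹)]
  refine mul_le_mul_of_nonneg_left ((Finset.abs_sum_le_sum_abs _ _).trans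
    (Finset.sum_le_sum fun I _ => ?_)) (by positivity)
  rw [abs_mul _ (∏ a, _), Finset.abs_prod]
  exact mul_le_of_le_one_right (abs_nonneg _)
    (Finset.prod_le_one (fun a _ => abs_nonneg _) fun a _ => abs_flip_le _ _)

theorem integrable_dhFunction {v : Fin n → ℝ} (hv : Δ.IsGeneric v) (c : M → ℝ) :
    Integrable (Δ.dhFunction v c) := by
  choose B hB using fun a : Fin n => Δ.exists_abs_dotProduct_le hv c (Pi.single a 1)
  obtain ⟨K, hK⟩ := Δ.exists_abs_dhFunction_le v c
  have hbox : IntegrableOn (Δ.dhFunction v c) (Set.Icc (-B) B) :=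
    Measure.integrableOn_of_bounded (M := K) isCompact_Icc.measure_ne_top
      (Δ.measurable_dhFunction v c).aestronglyMeasurable (Eventually.of_forall hK)
  refine hbox.integrable_of_forall_notMem_eq_zero fun u hu => ?_
  by_contra h
  refine hu ⟨fun a => ?_, fun a => ?_⟩
  · have := hB a u h
    rw [dotProduct_single_one] at this
    exact (abs_le.1 this).1
  · have := hB a u h
    rw [dotProduct_single_one] at this
    exact (abs_le.1 this).2

/-- The coefficients of the exponentials in the Laplace transform of the Duistermaat–Heckman
function. -/
noncomputable def residue (v : Fin n → ℝ) (I : Fin n → M) : ℝ :=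
  Δ.cycle.coeff I * ((Δ.rayMatrix I).det * ∏ a, Δ.coord v I a)⁻¹

theorem integral_dhFunction_mul_exp {v : Fin n → ℝ} (hv : Δ.IsGeneric v) (c : M → ℝ) {t : ℝ}
    (ht : 0 < t) :
    ∫ u : Fin n → ℝ, Δ.dhFunction v c u * Real.exp (t * (u ⬝ᵥ v)) =
      (∑ I : Fin n → M, ((n.factorial : ℝ)⁻¹ * Δ.residue v I) *
        Real.exp (t * ∑ a, Δ.coord v I a * c (I a))) / t ^ n := by
  have h1 : ∀ u, Δ.dhFunction v c u * Real.exp (t * (u ⬝ᵥ v)) = ∑ I : Fin n → M,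
      ((n.factorial : ℝ)⁻¹ * (Δ.cycle.coeff I * Real.sign (Δ.rayMatrix I).det)) *
        ((∏ a, flip (Δ.coord v I a) (u ⬝ᵥ Δ.ray (I a) - c (I a))) *
          Real.exp (t * (u ⬝ᵥ v))) := fun u => by
    rw [dhFunction, mul_assoc, Finset.sum_mul, Finset.mul_sum]
    exact Finset.sum_congr rfl fun I _ => by ring
  simp only [h1]
  rw [integral_finsetSum _ fun I _ => ?_, Finset.sum_div]
  · refine Finset.sum_congr rfl fun I _ => ?_
    by_cases hI : Δ.cycle.coeff I = 0
    · simp [hI, residue]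
    rw [integral_const_mul, Δ.integral_prod_flip_mul_exp hv hI c ht, residue]
    -- The orientation sign combines with the Jacobian `|det|⁻¹` into `det⁻¹`, the form found in
    -- `residue`.
    have hsign : Real.sign (Δ.rayMatrix I).det * |(Δ.rayMatrix I).det|⁻¹ =
        (Δ.rayMatrix I).det⁻¹ := by
      rcases lt_or_gt_of_ne (Δ.det_ne_zero hI) with h | h
      · rw [Real.sign_of_neg h, abs_of_neg h, inv_neg, neg_one_mul, neg_neg]
      · rw [Real.sign_of_pos h, abs_of_pos h, one_mul]
    rw [mul_inv, ← hsign, div_eq_mul_inv, mul_inv, div_eq_mul_inv]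
    ring
  · by_cases hI : Δ.cycle.coeff I = 0
    · simp [hI]
    · exact (Δ.integrable_prod_flip_mul_exp hv hI c ht).const_mul _

theorem tendsto_integral_dhFunction_mul_exp {v : Fin n → ℝ} (hv : Δ.IsGeneric v) (c : M → ℝ) :
    Tendsto (fun t : ℝ => ∫ u : Fin n → ℝ, Δ.dhFunction v c u * Real.exp (t * (u ⬝ᵥ v)))
      (𝓝[>] 0) (𝓝 (Δ.volume v c)) := by
  obtain ⟨B, hB⟩ := Δ.exists_abs_dotProduct_le hv c v
  refine tendsto_integral_filter_of_dominated_convergence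
    (fun u => |Δ.dhFunction v c u| * Real.exp B) (Eventually.of_forall fun t => ?_) ?_
    ((Δ.integrable_dhFunction hv c).abs.mul_const _) (Eventually.of_forall fun u => ?_)
  · refine ((Δ.measurable_dhFunction v c).mul ?_).aestronglyMeasurable
    simp only [dotProduct]
    fun_prop
  · filter_upwards [Ioo_mem_nhdsGT (zero_lt_one' ℝ)] with t ht
    refine Eventually.of_forall fun u => ?_
    rw [norm_mul, Real.norm_eq_abs, Real.norm_eq_abs, Real.abs_exp]
    by_cases hu : Δ.dhFunction v c u = 0
    · simp [hu]
    refine mul_le_mul_of_nonneg_left (Real.exp_le_exp.2 ?_) (abs_nonneg _)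
    have h1 := hB u hu
    have h2 : t * (u ⬝ᵥ v) ≤ t * B := mul_le_mul_of_nonneg_left ((le_abs_self _).trans h1) ht.1.le
    nlinarith [ht.2, ht.1, (abs_nonneg _).trans h1]
  · have h : Tendsto (fun t : ℝ => Δ.dhFunction v c u * Real.exp (t * (u ⬝ᵥ v))) (𝓝 0)
        (𝓝 (Δ.dhFunction v c u * Real.exp (0 * (u ⬝ᵥ v)))) :=
      Continuous.tendsto (by fun_prop) 0
    rw [zero_mul, Real.exp_zero, mul_one] at h
    exact h.mono_left nhdsWithin_le_nhds

/-- Lawrence's formula for the volume polynomial. -/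
noncomputable def lawrence (v : Fin n → ℝ) : MvPolynomial M ℝ :=
  ∑ I : Fin n → M, MvPolynomial.C ((n.factorial : ℝ)⁻¹ * (n.factorial : ℝ)⁻¹ * Δ.residue v I) *
    (∑ a, MvPolynomial.C (Δ.coord v I a) * MvPolynomial.X (I a)) ^ n

/-- Let `t → 0+` in the Laplace transform: the integral tends to the volume, the exponential sum to
its `n`-th Taylor coefficient. This supplies the second `1 / n!`; the first comes from counting
orderings. -/
theorem eval_lawrence {v : Fin n → ℝ} (hv : Δ.IsGeneric v) (c : M → ℝ) :
    MvPolynomial.eval c (Δ.lawrence v) = Δ.volume v c := by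
  have h := eq_sum_of_tendsto_sum_exp_div Finset.univ
    (fun I => (n.factorial : ℝ)⁻¹ * Δ.residue v I) (fun I => ∑ a, Δ.coord v I a * c (I a)) n
    (Δ.volume v c) ((Δ.tendsto_integral_dhFunction_mul_exp hv c).congr' (by
      filter_upwards [self_mem_nhdsWithin] with t ht
      exact Δ.integral_dhFunction_mul_exp hv c ht))
  rw [h, lawrence, map_sum, Finset.sum_div]
  refine Finset.sum_congr rfl fun I _ => ?_
  simp only [map_mul, map_pow, map_sum, MvPolynomial.eval_C, MvPolynomial.eval_X]
  ring

theorem volumePolynomial_eq {v : Fin n → ℝ} (hv : Δ.IsGeneric v) :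
    Δ.volumePolynomial = Δ.lawrence v := by
  have h : ∃ P, Δ.IsVolumePolynomial P := ⟨Δ.lawrence v, fun w hw c => by
    rw [Δ.eval_lawrence hv]
    exact integral_congr_ae (Eventually.of_forall fun u => Δ.dhFunction_eq hv hw c u)⟩
  refine MvPolynomial.funext fun c => ?_
  rw [volumePolynomial, dif_pos h, h.choose_spec v hv c, Δ.eval_lawrence hv]

theorem isHomogeneous_volumePolynomial : Δ.volumePolynomial.IsHomogeneous n := by
  obtain ⟨v, hv⟩ := Δ.exists_isGeneric
  rw [Δ.volumePolynomial_eq hv]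
  refine MvPolynomial.IsHomogeneous.sum _ _ _ fun I _ => ?_
  have h := (MvPolynomial.IsHomogeneous.sum Finset.univ
    (fun a => MvPolynomial.C (Δ.coord v I a) * MvPolynomial.X (I a)) (0 + 1) fun a _ =>
      (MvPolynomial.isHomogeneous_C M _).mul (MvPolynomial.isHomogeneous_X ℝ _)).pow n
  have h2 := (MvPolynomial.isHomogeneous_C M
    ((n.factorial : ℝ)⁻¹ * (n.factorial : ℝ)⁻¹ * Δ.residue v I)).mul h
  simpa using h2

end MultiFan

end Volume

/-! ### The derivative along `c_k` and the projected multi-fan -/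

namespace MultiFan

section Projection

open MvPolynomial

variable {M : Type*} [Fintype M] {n : ℕ}

theorem coord_comp_perm (Δ : MultiFan M n) (v : Fin n → ℝ) (I : Fin n → M)
    (σ : Equiv.Perm (Fin n)) : Δ.coord v (I ∘ σ) = Δ.coord v I ∘ σ := by
  have h : Δ.rayMatrix (I ∘ σ) = (Δ.rayMatrix I).submatrix σ (Equiv.refl _) := rfl
  rw [coord, h, Matrix.inv_submatrix_equiv]
  rfl

/-- The permutation signs of the weight and of the determinant cancel. -/
theorem residue_comp_perm (Δ : MultiFan M n) (v : Fin n → ℝ) (I : Fin n → M)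
    (σ : Equiv.Perm (Fin n)) : Δ.residue v (I ∘ σ) = Δ.residue v I := by
  have h : (Δ.rayMatrix (I ∘ σ)).det = (Equiv.Perm.sign σ : ℤ) * (Δ.rayMatrix I).det :=
    Matrix.det_permute σ (Δ.rayMatrix I)
  rw [residue, Δ.cycle.alternating, h, coord_comp_perm]
  simp only [Function.comp_apply]
  rw [Equiv.prod_comp σ (Δ.coord v I), residue]
  rcases Int.units_eq_one_or (Equiv.Perm.sign σ) with hσ | hσ <;> rw [hσ] <;> simp

/-- The linear form `∑ α_{I,a} c_{I a}`. -/
noncomputable def supportForm (Δ : MultiFan M n) (v : Fin n → ℝ) (I : Fin n → M) :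
    MvPolynomial M ℝ :=
  ∑ a, C (Δ.coord v I a) * X (I a)

theorem supportForm_comp_perm (Δ : MultiFan M n) (v : Fin n → ℝ) (I : Fin n → M)
    (σ : Equiv.Perm (Fin n)) : Δ.supportForm v (I ∘ σ) = Δ.supportForm v I := by
  rw [supportForm, coord_comp_perm]
  exact Equiv.sum_comp σ fun a => C (Δ.coord v I a) * X (I a)

theorem pderiv_supportForm [DecidableEq M] (Δ : MultiFan M n) (v : Fin n → ℝ) (I : Fin n → M)
    (k : M) : pderiv k (Δ.supportForm v I) = ∑ a, if I a = k then C (Δ.coord v I a) else 0 := by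
  rw [supportForm, map_sum]
  refine Finset.sum_congr rfl fun a _ => ?_
  simp [pderiv_X, Pi.single_apply]

theorem sum_ite_apply_zero_eq [DecidableEq M] {R : Type*} [AddCommMonoid R] (k : M)
    (f : (Fin (n + 1) → M) → R) :
    ∑ I : Fin (n + 1) → M, (if I 0 = k then f I else 0) =
      ∑ J : Fin n → M, f (Fin.cons k J) := by
  rw [← (Fin.consEquiv fun _ : Fin (n + 1) => M).sum_comp, Fintype.sum_prod_type_right]
  refine Finset.sum_congr rfl fun J _ => ?_
  simp [Fin.consEquiv]

/-- By symmetry each of the `n + 1` positions of `k` contributes as position `0` does, and the power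
rule gives another `n + 1`; together they turn `((n + 1)!)⁻²` into `(n!)⁻²`. The coordinate at `k`
produced by differentiation cancels the one in the residue. -/
theorem pderiv_lawrence (Δ : MultiFan M (n + 1)) {v : Fin (n + 1) → ℝ} (hv : Δ.IsGeneric v)
    (k : M) :
    pderiv k (Δ.lawrence v) = ∑ J : Fin n → M,
      C ((n.factorial : ℝ)⁻¹ * (n.factorial : ℝ)⁻¹ * (Δ.cycle.coeff (Fin.cons k J) *
        ((Δ.rayMatrix (Fin.cons k J)).det * ∏ b : Fin n, Δ.coord v (Fin.cons k J) b.succ)⁻¹)) *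
        Δ.supportForm v (Fin.cons k J) ^ n := by
  classical
  set N : ℝ := ((n + 1).factorial : ℝ)⁻¹ * ((n + 1).factorial : ℝ)⁻¹ with hN
  let f : Fin (n + 1) → (Fin (n + 1) → M) → MvPolynomial M ℝ := fun a I =>
    C (N * Δ.residue v I * (n + 1) * Δ.coord v I a) * Δ.supportForm v I ^ n
  have h1 : pderiv k (Δ.lawrence v) = ∑ I, ∑ a, if I a = k then f a I else 0 := by
    rw [lawrence, map_sum]
    refine Finset.sum_congr rfl fun I _ => ?_
    change pderiv k (C (N * Δ.residue v I) * Δ.supportForm v I ^ (n + 1)) = _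
    rw [Derivation.leibniz, pderiv_C, smul_zero, add_zero, Derivation.leibniz_pow,
      pderiv_supportForm, smul_eq_mul, smul_eq_mul, Finset.mul_sum, Finset.smul_sum,
      Finset.mul_sum]
    refine Finset.sum_congr rfl fun a _ => ?_
    split_ifs
    · simp only [f, map_mul, map_add, map_natCast, map_one, nsmul_eq_mul, Nat.add_sub_cancel,
        Nat.cast_add, Nat.cast_one]
      ring
    · simp
  have h2 : ∀ a, (∑ I : Fin (n + 1) → M, if I a = k then f a I else 0) =
      ∑ I : Fin (n + 1) → M, if I 0 = k then f 0 I else 0 := by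
    intro a
    refine Fintype.sum_equiv (Equiv.arrowCongr (Equiv.swap 0 a) (Equiv.refl M)) _ _ fun I => ?_
    have h3 : (Equiv.arrowCongr (Equiv.swap 0 a) (Equiv.refl M)) I = I ∘ Equiv.swap 0 a := by
      funext b; simp [Equiv.arrowCongr]
    rw [h3]
    simp only [f, residue_comp_perm, supportForm_comp_perm, coord_comp_perm, Function.comp_apply,
      Equiv.swap_apply_left]
  rw [h1, Finset.sum_comm]
  simp only [h2]
  rw [Finset.sum_const, Finset.card_univ, Fintype.card_fin, sum_ite_apply_zero_eq,
    Finset.smul_sum]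
  refine Finset.sum_congr rfl fun J _ => ?_
  simp only [f]
  rw [nsmul_eq_mul, ← map_natCast C, ← mul_assoc, ← map_mul]
  congr 2
  rw [residue, Fin.prod_univ_succ]
  by_cases hJ : Δ.cycle.coeff (Fin.cons k J) = 0
  · simp [hJ]
  have h4 := hv _ hJ 0
  have h5 : (n.factorial : ℝ) ≠ 0 := by positivity
  have h6 : (n + 1 : ℝ) ≠ 0 := by positivity
  rw [hN, Nat.factorial_succ]
  push_cast
  simp only [mul_inv]
  field_simp

/-- The matrix `R(k ⊔ J) A` is block triangular if `A` maps `λ(k)` to the first basis vector. -/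
theorem det_rayMatrix_cons_mul (Δ : MultiFan M (n + 1)) {k : M}
    {A : Matrix (Fin (n + 1)) (Fin (n + 1)) ℝ}
    (hk : Matrix.vecMul (Δ.ray k) A = Pi.single 0 1) (J : Fin n → M) :
    (Δ.rayMatrix (Fin.cons k J)).det * A.det =
      (Matrix.of fun a b : Fin n => Matrix.vecMul (Δ.ray (J a)) A b.succ).det := by
  rw [← Matrix.det_mul, Matrix.det_succ_row_zero, Finset.sum_eq_single 0]
  · have h : (Δ.rayMatrix (Fin.cons k J) * A) 0 0 = 1 := by
      have := congrFun hk 0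
      rw [Pi.single_eq_same] at this
      exact this
    rw [h]
    simp only [Fin.val_zero, pow_zero, one_mul]
    rfl
  · intro b _ hb
    have h : (Δ.rayMatrix (Fin.cons k J) * A) 0 b = 0 := by
      have := congrFun hk b
      rw [Pi.single_eq_of_ne hb] at this
      exact this
    rw [h]
    ring
  · simp

/-- The projected multi-fan, on the cycle `ω_k`, in coordinates in which `λ(k)` is the first basis
vector. -/
def projection (Δ : MultiFan M (n + 1)) (k : M) (A : Matrix (Fin (n + 1)) (Fin (n + 1)) ℝ)
    (hA : A.det ≠ 0) (hk : Matrix.vecMul (Δ.ray k) A = Pi.single 0 1) : MultiFan M n where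
  cycle := Δ.cycle.link k
  ray i b := Matrix.vecMul (Δ.ray i) A b.succ
  basis J hJ := by
    have hdet := Δ.det_rayMatrix_cons_mul hk J
    have hne : (Δ.rayMatrix (Fin.cons k J)).det * A.det ≠ 0 :=
      mul_ne_zero (Δ.det_ne_zero hJ) hA
    rw [hdet] at hne
    exact Matrix.linearIndependent_rows_iff_isUnit.2
      ((Matrix.isUnit_iff_isUnit_det _).2 hne.isUnit)

variable (Δ : MultiFan M (n + 1)) {k : M} {A : Matrix (Fin (n + 1)) (Fin (n + 1)) ℝ}
  (hA : A.det ≠ 0) (hk : Matrix.vecMul (Δ.ray k) A = Pi.single 0 1)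

theorem det_rayMatrix_projection (J : Fin n → M) :
    ((Δ.projection k A hA hk).rayMatrix J).det = (Δ.rayMatrix (Fin.cons k J)).det * A.det :=
  (Δ.det_rayMatrix_cons_mul hk J).symm

theorem vecMul_eq_sum_coord (A : Matrix (Fin (n + 1)) (Fin (n + 1)) ℝ) (v : Fin (n + 1) → ℝ)
    {I : Fin (n + 1) → M} (hI : Δ.cycle.coeff I ≠ 0) (d : Fin (n + 1)) :
    Matrix.vecMul v A d = ∑ a, Δ.coord v I a * Matrix.vecMul (Δ.ray (I a)) A d := by
  conv_lhs => rw [← Δ.coord_vecMul hI v, Matrix.vecMul_vecMul]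
  rfl

/-- Dropping the first coordinate after `A` kills `λ(k)`, so the expansion of `v` over `k ⊔ J`
descends to one over `J`. -/
theorem coord_projection (v : Fin (n + 1) → ℝ) {J : Fin n → M}
    (hJ : Δ.cycle.coeff (Fin.cons k J) ≠ 0) (b : Fin n) :
    (Δ.projection k A hA hk).coord (fun d => Matrix.vecMul v A d.succ) J b =
      Δ.coord v (Fin.cons k J) b.succ := by
  have h : (fun d : Fin n => Matrix.vecMul v A d.succ) =
      Matrix.vecMul (fun b : Fin n => Δ.coord v (Fin.cons k J) b.succ)
        ((Δ.projection k A hA hk).rayMatrix J) := by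
    funext d
    rw [Δ.vecMul_eq_sum_coord A v hJ, Fin.sum_univ_succ, Fin.cons_zero, hk,
      Pi.single_eq_of_ne (Fin.succ_ne_zero d), mul_zero, zero_add]
    simp only [Fin.cons_succ]
    rfl
  have hJ' : (Δ.projection k A hA hk).cycle.coeff J ≠ 0 := hJ
  rw [coord, h, Matrix.vecMul_vecMul, Matrix.mul_nonsing_inv _ (det_ne_zero _ hJ').isUnit,
    Matrix.vecMul_one]

theorem isGeneric_projection {v : Fin (n + 1) → ℝ} (hv : Δ.IsGeneric v) :
    (Δ.projection k A hA hk).IsGeneric fun d => Matrix.vecMul v A d.succ :=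
  fun J hJ b => by
    rw [Δ.coord_projection hA hk v hJ]
    exact hv _ hJ _

/-- The coefficients of the substitution `X i ↦ X i - ℓ i X k`. -/
def shear [DecidableEq M] (k : M) (l : M → ℝ) (i j : M) : ℝ :=
  (if i = j then 1 else 0) - if j = k then l i else 0

theorem linSubst_shear [DecidableEq M] (k : M) (l : M → ℝ) (i : M) :
    linSubst (shear k l) (X i) = X i - C (l i) * X k := by
  rw [linSubst_X]
  simp only [shear, map_sub, sub_mul, Finset.sum_sub_distrib, apply_ite C, map_one, map_zero,
    ite_mul, zero_mul, one_mul, Finset.sum_ite_eq, Finset.sum_ite_eq', Finset.mem_univ, if_true]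

/-- The derivative of the volume polynomial along `c_k` is, up to a factor and a linear
substitution, the volume polynomial of the projected multi-fan. -/
theorem pderiv_lawrence_eq [DecidableEq M] {v : Fin (n + 1) → ℝ} (hv : Δ.IsGeneric v)
    (h0 : n ≠ 0 → Matrix.vecMul v A 0 = 0) :
    pderiv k (Δ.lawrence v) = C A.det * linSubst (shear k fun i => Matrix.vecMul (Δ.ray i) A 0)
      ((Δ.projection k A hA hk).lawrence fun d => Matrix.vecMul v A d.succ) := by
  rw [Δ.pderiv_lawrence hv, lawrence, map_sum, Finset.mul_sum]
  refine Finset.sum_congr rfl fun J _ => ?_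
  by_cases hJ : Δ.cycle.coeff (Fin.cons k J) = 0
  · have hJ' : (Δ.projection k A hA hk).cycle.coeff J = 0 := hJ
    simp [hJ, hJ', residue]
  have hcoeff : (Δ.projection k A hA hk).cycle.coeff J = Δ.cycle.coeff (Fin.cons k J) := rfl
  have hform : Δ.supportForm v (Fin.cons k J) ^ n =
      linSubst (shear k fun i => Matrix.vecMul (Δ.ray i) A 0)
        ((∑ a, C ((Δ.projection k A hA hk).coord (fun d => Matrix.vecMul v A d.succ) J a) *
          X (J a)) ^ n) := by
    rcases eq_or_ne n 0 with rfl | hn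
    · simp
    have hsum := Δ.vecMul_eq_sum_coord A v hJ 0
    -- The first coordinate of `v A` being zero determines the coefficient of `X k` from the others,
    -- which is exactly the effect of the shear.
    rw [h0 hn, Fin.sum_univ_succ, Fin.cons_zero, hk, Pi.single_eq_same, mul_one] at hsum
    simp only [Fin.cons_succ] at hsum
    rw [map_pow, map_sum]
    congr 1
    simp only [Δ.coord_projection hA hk v hJ, map_mul, linSubst_shear, linSubst_C]
    rw [supportForm, Fin.sum_univ_succ, Fin.cons_zero, eq_neg_of_add_eq_zero_left hsum.symm]
    simp only [Fin.cons_succ, map_neg, map_sum, mul_sub, Finset.sum_sub_distrib, Finset.sum_mul,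
      neg_mul, map_mul, mul_assoc]
    rw [neg_add_eq_sub]
  rw [hform, map_mul (linSubst _) (C _), linSubst_C, ← mul_assoc (C A.det), ← map_mul C A.det]
  congr 2
  rw [residue, hcoeff, Δ.det_rayMatrix_projection]
  simp only [Δ.coord_projection hA hk v hJ, mul_inv]
  field_simp

/-- Simplices of nonzero weight in the link avoid `k`, so `X k` does not occur in the projected
polynomial and setting it to `0` undoes the shear. -/
theorem linSubst_linSubst_shear_lawrence [DecidableEq M] (l : M → ℝ) (w : Fin n → ℝ) :
    linSubst (fun i j => if i = j ∧ i ≠ k then 1 else 0)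
      (linSubst (shear k l) ((Δ.projection k A hA hk).lawrence w)) =
      (Δ.projection k A hA hk).lawrence w := by
  have hX : ∀ i, linSubst (fun i j : M => if i = j ∧ i ≠ k then (1 : ℝ) else 0) (X i) =
      if i = k then 0 else X i := fun i => by
    rw [linSubst_X]
    by_cases h : i = k
    · simp [h]
    · simp [h, apply_ite C]
  simp only [lawrence, map_sum]
  refine Finset.sum_congr rfl fun J _ => ?_
  by_cases hJ : Δ.cycle.coeff (Fin.cons k J) = 0
  · have hJ' : (Δ.projection k A hA hk).cycle.coeff J = 0 := hJ
    simp [hJ', residue]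
  have hne : ∀ b, J b ≠ k := fun b hb => hJ (Δ.cycle.coeff_eq_zero (Fin.succ_ne_zero b)
    (by rw [Fin.cons_succ, Fin.cons_zero, hb]))
  simp only [map_mul, map_pow, map_sum, linSubst_C, linSubst_shear, map_sub, hX, hne, if_true, if_false,
    mul_zero, sub_zero]

/-- Coordinates in which `λ(k)` is the first basis vector, and the first coordinate of a given
generic vector vanishes. -/
theorem exists_adapted_matrix {v : Fin (n + 1) → ℝ} (hv : Δ.IsGeneric v) {J : Fin n → M}
    (hJ : Δ.cycle.coeff (Fin.cons k J) ≠ 0) :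
    ∃ A : Matrix (Fin (n + 1)) (Fin (n + 1)) ℝ, A.det ≠ 0 ∧
      Matrix.vecMul (Δ.ray k) A = Pi.single 0 1 ∧ (n ≠ 0 → Matrix.vecMul v A 0 = 0) := by
  set R := Δ.rayMatrix (Fin.cons k J)
  have hR : R⁻¹.det ≠ 0 := by
    rw [Matrix.det_nonsing_inv, Ring.inverse_eq_inv']
    exact inv_ne_zero (Δ.det_ne_zero hJ)
  have hk : Matrix.vecMul (Δ.ray k) R⁻¹ = Pi.single 0 1 := Δ.coord_ray hJ 0
  rcases n with _ | m
  · exact ⟨R⁻¹, hR, hk, fun h => absurd rfl h⟩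
  set α := Δ.coord v (Fin.cons k J)
  have hα : α 1 ≠ 0 := hv _ hJ 1
  have hT : ∀ (x : Fin (m + 2) → ℝ) (r : ℝ),
      Matrix.vecMul x (Matrix.transvection 1 0 r) = x + Pi.single 0 (x 1 * r) := fun x r => by
    rw [Matrix.transvection, Matrix.vecMul_add, Matrix.vecMul_one]
    congr 1
    funext d
    simp [Matrix.vecMul, dotProduct, Matrix.single_apply, Pi.single_apply, ite_and, eq_comm]
  -- A column operation clears coordinate `0` of `v`, using that coordinate `1` is nonzero by
  -- genericity, and fixes the image of `λ(k)`, whose coordinate `1` is zero. In dimension one `v`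
  -- is a multiple of `λ(k)` and this cannot be done, hence the condition `n ≠ 0`.
  refine ⟨R⁻¹ * Matrix.transvection 1 0 (-(α 0 / α 1)), ?_, ?_, fun _ => ?_⟩
  · rw [Matrix.det_mul, Matrix.det_transvection_of_ne _ _ (by simp), mul_one]
    exact hR
  · rw [← Matrix.vecMul_vecMul, hk, hT]
    simp
  · rw [← Matrix.vecMul_vecMul]
    change Matrix.vecMul α _ 0 = 0
    rw [hT]
    simp only [Pi.add_apply, Pi.single_eq_same]
    field_simp
    ring

theorem exists_projection (k : M) : ∃ Δₖ : MultiFan M n, Δₖ.cycle = Δ.cycle.link k ∧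
    ∀ j, Module.finrank ℝ (derivSpace (pderiv k Δ.volumePolynomial) j) = Δₖ.hilbertFunction j := by
  classical
  obtain ⟨v, hv⟩ := Δ.exists_isGeneric
  by_cases h : ∃ J : Fin n → M, Δ.cycle.coeff (Fin.cons k J) ≠ 0
  · obtain ⟨J, hJ⟩ := h
    obtain ⟨A, hA, hk, h0⟩ := Δ.exists_adapted_matrix hv hJ
    refine ⟨Δ.projection k A hA hk, rfl, fun j => ?_⟩
    rw [hilbertFunction_eq, volumePolynomial_eq _ (Δ.isGeneric_projection hA hk hv),
      Δ.volumePolynomial_eq hv, Δ.pderiv_lawrence_eq hA hk hv h0, derivSpace_C_mul hA]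
    exact finrank_derivSpace_linSubst _ _ _ (Δ.linSubst_linSubst_shear_lawrence hA hk _ _) j
  -- No weighted simplex contains `k`, so `λ(k)` may even be `0`. The link is the zero cycle, any
  -- rays serve, and both polynomials vanish.
  · push Not at h
    let Δₖ : MultiFan M n := ⟨Δ.cycle.link k, fun _ _ => 0, fun J hJ => absurd (h J) hJ⟩
    refine ⟨Δₖ, rfl, fun j => ?_⟩
    have hw : Δₖ.IsGeneric 0 := fun J hJ => absurd (h J) hJ
    have h1 : Δₖ.volumePolynomial = 0 := by
      rw [volumePolynomial_eq _ hw, lawrence]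
      refine Finset.sum_eq_zero fun J _ => ?_
      rw [residue, show Δₖ.cycle.coeff J = 0 from h J]
      simp
    have h2 : pderiv k Δ.volumePolynomial = 0 := by
      rw [Δ.volumePolynomial_eq hv, Δ.pderiv_lawrence hv]
      refine Finset.sum_eq_zero fun J _ => ?_
      rw [h J]
      simp
    rw [hilbertFunction_eq, h1, h2]

end Projection

end MultiFan

/-! ### The volume polynomial of `T = Δ'' - Δ'` -/

section Difference

open MvPolynomial

variable {M : Type*} {n : ℕ}

theorem inclusion_injective [DecidableEq M] (k : M) (b : Bool) : Function.Injective (inclusion k (Sum.inr b)) := by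
  intro i j h
  by_cases hi : i = k <;> by_cases hj : j = k
  · rw [hi, hj]
  · simp [inclusion, hi, hj] at h
  · simp [inclusion, hi, hj] at h
  · simpa [inclusion, hi, hj] using h

theorem inclusion_self [DecidableEq M] (k : M) (p : Doubled k) : inclusion k p k = p := by
  simp [inclusion]

theorem inclusion_ne [DecidableEq M] (k : M) {b b' : Bool} (h : b ≠ b') (i : M) :
    inclusion k (Sum.inr b) i ≠ Sum.inr b' := by
  by_cases hi : i = k
  · simpa [inclusion, hi] using h
  · simp [inclusion, hi]

variable [Fintype M]

theorem pderiv_rename_eq_zero {N : Type*} [Fintype N] (f : M → N) {x : N} (hx : ∀ i, f i ≠ x)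
    (P : MvPolynomial M ℝ) : pderiv x (rename f P) = 0 := by
  classical
  rw [rename_eq_linSubst, pderiv_linSubst]
  exact Finset.sum_eq_zero fun i _ => by rw [if_neg (hx i), C_0, zero_mul]

namespace SimplicialCycle

theorem sum_map_coeff_smul {N : Type*} [Fintype N] [DecidableEq N] (f : M → N)
    (ω : SimplicialCycle M n) (G : (Fin n → N) → MvPolynomial N ℝ) :
    ∑ I, (ω.map f).coeff I • G I = ∑ J, ω.coeff J • G (f ∘ J) := by
  have h : ∀ I, (ω.map f).coeff I • G I =
      ∑ J : Fin n → M, if f ∘ J = I then ω.coeff J • G I else 0 := fun I => by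
    change (∑ J : Fin n → M, if f ∘ J = I then ω.coeff J else 0) • G I = _
    rw [Finset.sum_smul]
    exact Finset.sum_congr rfl fun J _ => by split_ifs <;> simp
  simp only [h]
  rw [Finset.sum_comm]
  refine Finset.sum_congr rfl fun J _ => ?_
  simp

end SimplicialCycle

namespace MultiFan

/-- The summand of Lawrence's formula for a simplex of weight `1`. -/
noncomputable def lawrenceTerm {N : Type*} [Fintype N] (Δ : MultiFan N n) (v : Fin n → ℝ)
    (I : Fin n → N) : MvPolynomial N ℝ :=
  C ((n.factorial : ℝ)⁻¹ * (n.factorial : ℝ)⁻¹ *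
    ((Δ.rayMatrix I).det * ∏ a, Δ.coord v I a)⁻¹) * Δ.supportForm v I ^ n

theorem lawrence_eq_sum {N : Type*} [Fintype N] (Δ : MultiFan N n) (v : Fin n → ℝ) :
    Δ.lawrence v = ∑ I, Δ.cycle.coeff I • Δ.lawrenceTerm v I := by
  refine Finset.sum_congr rfl fun I _ => ?_
  rw [lawrenceTerm, smul_eq_C_mul, ← mul_assoc, ← map_mul, residue, supportForm]
  congr 2
  ring

theorem coord_comp_of_ray_eq {N : Type*} [Fintype N] (Δ : MultiFan M n) (T : MultiFan N n)
    {f : M → N} (hf : ∀ i, T.ray (f i) = Δ.ray i) (v : Fin n → ℝ) (J : Fin n → M) :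
    T.coord v (f ∘ J) = Δ.coord v J := by
  have hR : T.rayMatrix (f ∘ J) = Δ.rayMatrix J := by
    ext a b
    exact congrFun (hf (J a)) b
  rw [coord, coord, hR]

theorem lawrenceTerm_comp {N : Type*} [Fintype N] (Δ : MultiFan M n) (T : MultiFan N n)
    {f : M → N} (hf : ∀ i, T.ray (f i) = Δ.ray i) (v : Fin n → ℝ) (J : Fin n → M) :
    T.lawrenceTerm v (f ∘ J) = rename f (Δ.lawrenceTerm v J) := by
  have hR : T.rayMatrix (f ∘ J) = Δ.rayMatrix J := by
    ext a b
    exact congrFun (hf (J a)) b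
  have hα := coord_comp_of_ray_eq Δ T hf v J
  simp only [lawrenceTerm, supportForm, hR, hα, map_mul, map_pow, map_sum, rename_C, rename_X,
    Function.comp_apply]

variable [DecidableEq M] {k : M} {Δ' Δ'' : MultiFan M n} (hray : ∀ i, i ≠ k → Δ'.ray i = Δ''.ray i)

theorem difference_ray_inclusion_apexX (i : M) :
    (difference k Δ' Δ'' hray).ray (inclusion k (apexX k) i) = Δ'.ray i := by
  change doubledRay k Δ'.ray Δ''.ray _ = _
  by_cases h : i = k
  · subst h; simp [inclusion, apexX, doubledRay]
  · simp [inclusion, h, doubledRay]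

theorem difference_ray_inclusion_apexY (i : M) :
    (difference k Δ' Δ'' hray).ray (inclusion k (apexY k) i) = Δ''.ray i := by
  change doubledRay k Δ'.ray Δ''.ray _ = _
  by_cases h : i = k
  · subst h; simp [inclusion, apexY, doubledRay]
  · simp [inclusion, h, doubledRay, hray i h]

theorem isGeneric_difference {v : Fin n → ℝ} (hv' : Δ'.IsGeneric v) (hv'' : Δ''.IsGeneric v) :
    (difference k Δ' Δ'' hray).IsGeneric v := by
  intro I hI a
  have hI' : (Δ''.cycle.map (inclusion k (apexY k))).coeff I ≠ 0 ∨
      (Δ'.cycle.map (inclusion k (apexX k))).coeff I ≠ 0 := by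
    by_contra! hcon
    refine hI ?_
    change (Δ''.cycle.map (inclusion k (apexY k))).coeff I -
      (Δ'.cycle.map (inclusion k (apexX k))).coeff I = 0
    rw [hcon.1, hcon.2, sub_zero]
  rcases hI' with h | h
  · obtain ⟨J, -, hJ⟩ := Finset.exists_ne_zero_of_sum_ne_zero h
    obtain ⟨rfl, hJ'⟩ := ite_ne_right_iff.1 hJ
    rw [coord_comp_of_ray_eq Δ'' _ (difference_ray_inclusion_apexY hray)]
    exact hv'' J hJ' a
  · obtain ⟨J, -, hJ⟩ := Finset.exists_ne_zero_of_sum_ne_zero h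
    obtain ⟨rfl, hJ'⟩ := ite_ne_right_iff.1 hJ
    rw [coord_comp_of_ray_eq Δ' _ (difference_ray_inclusion_apexX hray)]
    exact hv' J hJ' a

/-- For a vector generic for both multi-fans, Lawrence's formula is linear in the cycle, with terms
depending only on the rays. -/
theorem volumePolynomial_difference :
    (difference k Δ' Δ'' hray).volumePolynomial =
      rename (inclusion k (apexY k)) Δ''.volumePolynomial -
        rename (inclusion k (apexX k)) Δ'.volumePolynomial := by
  obtain ⟨v, hv', hv''⟩ := Δ'.exists_isGeneric_isGeneric Δ''
  set T := difference k Δ' Δ'' hray with hT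
  have hsub : ∀ I, T.cycle.coeff I = (Δ''.cycle.map (inclusion k (apexY k))).coeff I -
      (Δ'.cycle.map (inclusion k (apexX k))).coeff I := fun I => rfl
  have hX : ∀ i, T.ray (inclusion k (apexX k) i) = Δ'.ray i := difference_ray_inclusion_apexX hray
  have hY : ∀ i, T.ray (inclusion k (apexY k) i) = Δ''.ray i := difference_ray_inclusion_apexY hray
  rw [T.volumePolynomial_eq (isGeneric_difference hray hv' hv''), Δ'.volumePolynomial_eq hv',
    Δ''.volumePolynomial_eq hv'', lawrence_eq_sum, lawrence_eq_sum, lawrence_eq_sum]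
  simp only [hsub, sub_smul]
  rw [Finset.sum_sub_distrib, SimplicialCycle.sum_map_coeff_smul,
    SimplicialCycle.sum_map_coeff_smul, map_sum, map_sum]
  simp only [lawrenceTerm_comp Δ' T hX, lawrenceTerm_comp Δ'' T hY, map_smul]

/-- The inclusion `ker (× ∂_x) ⊆ im (× ∂_y)`, lifted from the quotient to operators acting on `V_T`.
-/
theorem Editable.exists_eq {N : Type*} [Fintype N] {T : MultiFan N (n + 1)} {x y : N}
    (hT : T.Editable x y) (D : MvPolynomial N ℝ) (hD : diffOp (X x * D) T.volumePolynomial = 0) :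
    ∃ E, diffOp D T.volumePolynomial = diffOp (X y * E) T.volumePolynomial := by
  have hmem : (Ideal.Quotient.mk (annihilator T.volumePolynomial) D : T.DualityAlgebra) ∈
      LinearMap.ker (LinearMap.mulLeft ℝ (T.partialClass x)) := by
    rw [LinearMap.mem_ker, LinearMap.mulLeft_apply, partialClass, ← map_mul]
    exact Ideal.Quotient.eq_zero_iff_mem.2 hD
  rw [← hT.2] at hmem
  obtain ⟨e, he⟩ := hmem
  obtain ⟨E, rfl⟩ := Ideal.Quotient.mk_surjective e
  rw [LinearMap.mulLeft_apply, partialClass, ← map_mul, eq_comm, Ideal.Quotient.eq] at he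
  refine ⟨E, sub_eq_zero.1 ?_⟩
  rw [← LinearMap.sub_apply, ← map_sub]
  exact he

end MultiFan

end Difference

end MFan

/-! ### Assembly of the theorem -/

theorem mainTheorem2 {M : Type*} [Fintype M] [DecidableEq M] {n : ℕ}
    (Δ' Δ'' : MFan.MultiFan M (n + 1)) (k : M)
    (hcycle : Δ'.cycle = Δ''.cycle)
    (hray : ∀ i, i ≠ k → Δ'.ray i = Δ''.ray i)
    (hrigid : (Δ'.cycle.link k).Rigid)
    (hT : (MFan.MultiFan.difference k Δ' Δ'' hray).Editable (MFan.apexX k) (MFan.apexY k)) :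
    Δ'.hilbertFunction = Δ''.hilbertFunction := by
  obtain ⟨Δ₁, hΔ₁, h₁⟩ := Δ'.exists_projection k
  obtain ⟨Δ₂, hΔ₂, h₂⟩ := Δ''.exists_projection k
  -- The two projected multi-fans share the cycle `ω_k` but may have different rays; this is where
  -- rigidity enters.
  have hlink := hrigid Δ₁ Δ₂ hΔ₁ (by rw [hΔ₂, hcycle])
  have hinjX := MFan.inclusion_injective k false
  have hinjY := MFan.inclusion_injective k true
  have hx := MFan.pderiv_rename_eq_zero (MFan.inclusion k (MFan.apexY k))
    (MFan.inclusion_ne k (b := true) (b' := false) (by simp)) Δ''.volumePolynomial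
  have hy := MFan.pderiv_rename_eq_zero (MFan.inclusion k (MFan.apexX k))
    (MFan.inclusion_ne k (b := false) (b' := true) (by simp)) Δ'.volumePolynomial
  have hdX := MvPolynomial.pderiv_rename hinjX k Δ'.volumePolynomial
  have hdY := MvPolynomial.pderiv_rename hinjY k Δ''.volumePolynomial
  rw [MFan.inclusion_self] at hdX hdY
  have hed := hT.exists_eq
  rw [MFan.MultiFan.volumePolynomial_difference] at hed
  funext j
  rw [MFan.MultiFan.hilbertFunction_eq, MFan.MultiFan.hilbertFunction_eq,
    ← MFan.finrank_derivSpace_rename hinjX, ← MFan.finrank_derivSpace_rename hinjY]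
  refine MFan.finrank_derivSpace_eq_of_editable
    (Δ'.isHomogeneous_volumePolynomial.rename_isHomogeneous)
    (Δ''.isHomogeneous_volumePolynomial.rename_isHomogeneous) hx hy hed (fun i => ?_) j
  have e₁ := (MFan.finrank_derivSpace_rename hinjX
    (MvPolynomial.pderiv k Δ'.volumePolynomial) i).trans (h₁ i)
  have e₂ := (MFan.finrank_derivSpace_rename hinjY
    (MvPolynomial.pderiv k Δ''.volumePolynomial) i).trans (h₂ i)
  rw [← hdX] at e₁
  rw [← hdY] at e₂
  exact e₁.trans ((congrFun hlink i).trans e₂.symm)
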